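/- Let $(X_k)_{k\ge 1}$ be independent identically distributed real random variables with $E[X_k]=0$ and $E[X_k^2]=1$, let $F$ be their common cumulative distribution function, and assume that the generalized inverse $F^{-1}(u):=\inf\{s\in\mathbb{R} : F(s)\ge u\}$ is continuously differentiable on $(0,1)$. Let $$\varphi_X(y):=-\frac{1}{F'(y)}\int_{-\infty}^y x\,dF(x)$$ be the Stein kernel of $X_1$ (with $\varphi_X(y):=0$ where $F$ has no finite non-zero derivative). Let $A=(a_{k,l})_{1\le k,l\le n}$ be a real symmetric matrix with vanishing diagonal such that the quadratic form $$Q_n:=\sum_{1\le k,l\le n}a_{k,l}X_kX_l$$ is normalized by $E[Q_n^2]=1$, and put $L_n^2:=\max_{1\le k\le n}\sum_{l=1}^n a_{k,l}^2$. Let $\mathcal N$ be a standard normal random variable, and let $d_W(X,Y):=\sup_h|E[h(X)]-E[h(Y)]|$, with the supremum over all real functions $h$ with Lipschitz constant at most $1$, and $d_{TV}(X,Y):=\sup_B|P(X\in B)-P(Y\in B)|$, with the supremum over all Borel sets $B\subset\mathbb{R}$. Then $$d_W(Q_n,\mathcal N)\le 4\sqrt{E[\varphi_X(X_1)^2]\,(2+E[X_1^4])\,L_n^2+2\sum_{1\le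 q,l\le n}\Big(\sum_{k=1}^n a_{k,q}a_{k,l}\Big)^2-\sum_{k=1}^n\Big(\sum_{l=1}^{k-1}a_{k,l}^2\Big)^2}$$ and $$d_{TV}(Q_n,\mathcal N)\le 8\sqrt{E[\varphi_X(X_1)^2]\,(2+E[X_1^4])\,L_n^2+2\sum_{1\le q,l\le n}\Big(\sum_{k=1}^n a_{k,q}a_{k,l}\Big)^2-\sum_{k=1}^n\Big(\sum_{l=1}^{k-1}a_{k,l}^2\Big)^2},$$ where the right-hand sides are $+\infty$ if $E[\varphi_X(X_1)^2]$ or $E[X_1^4]$ is infinite. -/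

import Mathlib

open MeasureTheory ProbabilityTheory
open scoped ENNReal

namespace SteinQuadForm

noncomputable section

/-- Wasserstein distance between two laws on the real line: the supremum of
`|∫ h dμ - ∫ h dν|` over all real functions `h` with Lipschitz constant at most `1`
(meant for laws with a finite first moment). -/
def wassersteinDist (μ ν : Measure ℝ) : ℝ≥0∞ :=
  ⨆ (h : ℝ → ℝ) (_ : LipschitzWith 1 h), ENNReal.ofReal |∫ x, h x ∂μ - ∫ x, h x ∂ν|

/-- Total variation distance between two laws on the real line: the supremum of
`|μ A - ν A|` over all Borel sets `A`. -/
def totalVariationDist (μ ν : Measure ℝ) : ℝ≥0∞ :=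
  ⨆ (A : Set ℝ) (_ : MeasurableSet A), ENNReal.ofReal |μ.real A - ν.real A|

/-- Generalized inverse of the cumulative distribution function `F` of the law `μ`:
`F⁻¹(u) = inf {s : F(s) ≥ u}`, for `0 < u < 1`. -/
def quantile (μ : Measure ℝ) (u : ℝ) : ℝ :=
  sInf {s : ℝ | u ≤ cdf μ s}

/-- Stein kernel of a centered law `μ` with cumulative distribution function `F`:
`φ(y) = -(1 / F'(y)) ∫_{-∞}^y x dF(x)`. -/
def steinKernel (μ : Measure ℝ) (y : ℝ) : ℝ :=
  -(1 / deriv (cdf μ) y) * ∫ x in Set.Iic y, x ∂μ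

variable {n : ℕ}

/-- The quadratic form `Q_n = ∑_{k,l} a_{k,l} X_k X_l`. -/
def quadForm {Ω : Type*} (a : Matrix (Fin n) (Fin n) ℝ) (X : ℕ → Ω → ℝ) (ω : Ω) : ℝ :=
  ∑ k, ∑ l, a k l * X k ω * X l ω

/-- `L_n² = max_k ∑_l a_{k,l}²`. -/
def maxRowSq (a : Matrix (Fin n) (Fin n) ℝ) : ℝ :=
  ⨆ k, ∑ l, a k l ^ 2

/-- `2 ∑_{q,l} (∑_k a_{k,q} a_{k,l})² - ∑_k (∑_{l<k} a_{k,l}²)²`. -/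
def contractionTerm (a : Matrix (Fin n) (Fin n) ℝ) : ℝ :=
  2 * ∑ q, ∑ l, (∑ k, a k q * a k l) ^ 2 - ∑ k, (∑ l with l < k, a k l ^ 2) ^ 2

/-- The contraction term of a symmetric matrix is nonnegative, so that its truncation
`ENNReal.ofReal (contractionTerm a)` loses nothing. -/
theorem contractionTerm_nonneg (a : Matrix (Fin n) (Fin n) ℝ) (ha : a.IsSymm) :
    0 ≤ contractionTerm a := by
  have h1 : ∑ k, (∑ l with l < k, a k l ^ 2) ^ 2 ≤
      ∑ q, ∑ l, (∑ k, a k q * a k l) ^ 2 := by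
    refine Finset.sum_le_sum fun q _ => ?_
    refine le_trans ?_ (Finset.single_le_sum (f := fun l => (∑ k, a k q * a k l) ^ 2)
      (fun _ _ => sq_nonneg _) (Finset.mem_univ q))
    have h2 : ∑ k, a k q * a k q = ∑ l, a q l ^ 2 := by
      refine Finset.sum_congr rfl fun k _ => ?_
      rw [ha.apply q k, sq]
    simp only [h2]
    have h3 : ∑ l with l < q, a q l ^ 2 ≤ ∑ l, a q l ^ 2 :=
      Finset.sum_le_sum_of_subset_of_nonneg (Finset.filter_subset _ _)
        fun _ _ _ => sq_nonneg _
    have h4 : 0 ≤ ∑ l with l < q, a q l ^ 2 := Finset.sum_nonneg fun _ _ => sq_nonneg _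
    exact pow_le_pow_left₀ h4 h3 2
  have h5 : 0 ≤ ∑ q, ∑ l, (∑ k, a k q * a k l) ^ 2 :=
    Finset.sum_nonneg fun _ _ => Finset.sum_nonneg fun _ _ => sq_nonneg _
  unfold contractionTerm
  linarith

/-- The root `√(E[φ(X)²] (2 + E[X⁴]) L_n² + contractionTerm a)`, where `X` has law `μ`.
Both expectations are computed in `[0, ∞]`, so the root is `∞` if one of them is infinite
(and `L_n > 0`). -/
def boundRoot (μ : Measure ℝ) (a : Matrix (Fin n) (Fin n) ℝ) : ℝ≥0∞ :=
  ((∫⁻ x, ENNReal.ofReal (steinKernel μ x ^ 2) ∂μ)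
      * (2 + ∫⁻ x, ENNReal.ofReal (x ^ 4) ∂μ) * ENNReal.ofReal (maxRowSq a)
    + ENNReal.ofReal (contractionTerm a)) ^ (1 / 2 : ℝ)

end

end SteinQuadForm

/-! Integrating by parts on `(0, 1)` through the quantile function gives
`E[X f(X)] = E[φ(X) f'(X)]`. Applied in each variable to `Q = ∑ aₖₗ xₖ xₗ`, whose partial
derivatives are `2 Tₖ` with `Tₖ = ∑ₗ aₖₗ xₗ` independent of `xₖ`, it shows that
`H = 2 ∑ₖ φ(xₖ) Tₖ²` is a Stein kernel of `Q`. If `f` solves the Stein equation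
`f' - x f = h - E[h(N)]`, then `E[h(Q)] - E[h(N)] = E[(1 - H) f'(Q)]`, so bounds on `f'` reduce
both distances to the `L²` norm of `1 - H`. As `φ(xₖ)` has mean one, `1 - H` splits into
`2 ∑ₖ (1 - φ(xₖ)) Tₖ²`, where resampling `xₖ` makes different terms almost orthogonal, and
`1 - 2 ∑ₖ Tₖ²`, whose variance is a Wick computation. -/

namespace SteinQuadForm

open Set Filter Topology

section Quantile

variable {μ : Measure ℝ} {u : ℝ}

lemma bddBelow_setOf_le_cdf (μ : Measure ℝ) (hu : 0 < u) : BddBelow {s : ℝ | u ≤ cdf μ s} := by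
  obtain ⟨b, hb⟩ := ((tendsto_cdf_atBot μ).eventually (gt_mem_nhds hu)).exists
  refine ⟨b, fun s hs => ?_⟩
  by_contra! hsb
  exact absurd (hs.trans (monotone_cdf μ hsb.le)) hb.not_ge

lemma nonempty_setOf_le_cdf (μ : Measure ℝ) (hu : u < 1) : {s : ℝ | u ≤ cdf μ s}.Nonempty := by
  obtain ⟨b, hb⟩ := ((tendsto_cdf_atTop μ).eventually (lt_mem_nhds hu)).exists
  exact ⟨b, hb.le⟩

lemma le_cdf_quantile (μ : Measure ℝ) (hu : u < 1) : u ≤ cdf μ (quantile μ u) := by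
  have hright : Tendsto (cdf μ) (𝓝[>] (quantile μ u)) (𝓝 (cdf μ (quantile μ u))) :=
    ((cdf μ).right_continuous _).mono_left (nhdsWithin_mono _ Ioi_subset_Ici_self)
  refine ge_of_tendsto hright ?_
  filter_upwards [self_mem_nhdsWithin] with s hs
  obtain ⟨t, ht, hts⟩ := exists_lt_of_csInf_lt (nonempty_setOf_le_cdf μ hu) hs
  exact ht.trans (monotone_cdf μ hts.le)

lemma quantile_le_iff (μ : Measure ℝ) (hu : u ∈ Ioo (0 : ℝ) 1) (s : ℝ) :
    quantile μ u ≤ s ↔ u ≤ cdf μ s :=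
  ⟨fun h => (le_cdf_quantile μ hu.2).trans (monotone_cdf μ h),
    fun h => csInf_le (bddBelow_setOf_le_cdf μ hu.1) h⟩

lemma monotoneOn_quantile (μ : Measure ℝ) : MonotoneOn (quantile μ) (Ioo 0 1) :=
  fun _ hu _ hv huv => (quantile_le_iff μ hu _).2 (huv.trans (le_cdf_quantile μ hv.2))

lemma aemeasurable_quantile (μ : Measure ℝ) :
    AEMeasurable (quantile μ) (volume.restrict (Ioo (0 : ℝ) 1)) :=
  aemeasurable_restrict_of_monotoneOn measurableSet_Ioo (monotoneOn_quantile μ)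

lemma map_quantile (μ : Measure ℝ) [IsProbabilityMeasure μ] :
    (volume.restrict (Ioo (0 : ℝ) 1)).map (quantile μ) = μ := by
  have hfin : IsFiniteMeasure ((volume.restrict (Ioo (0 : ℝ) 1)).map (quantile μ)) := inferInstance
  refine Measure.ext_of_Iic _ _ fun s => ?_
  have hpre : quantile μ ⁻¹' Iic s ∩ Ioo 0 1 = Iic (cdf μ s) ∩ Ioo 0 1 := by
    ext u
    simp only [mem_inter_iff, mem_preimage, mem_Iic]
    exact and_congr_left fun hu => quantile_le_iff μ hu s
  rw [Measure.map_apply_of_aemeasurable (aemeasurable_quantile μ) measurableSet_Iic,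
    Measure.restrict_apply₀' measurableSet_Ioo.nullMeasurableSet, hpre, ← ofReal_cdf]
  apply le_antisymm
  · refine (measure_mono (t := Ioc 0 (cdf μ s)) fun u hu => ⟨hu.2.1, hu.1⟩).trans ?_
    simp
  · refine le_trans ?_ (measure_mono (s := Ioo 0 (cdf μ s))
      fun u hu => ⟨hu.2.le, hu.1, hu.2.trans_le (cdf_le_one μ s)⟩)
    simp

lemma integral_quantile [IsProbabilityMeasure μ] {f : ℝ → ℝ} (hf : AEStronglyMeasurable f μ) :
    ∫ u in Ioo (0 : ℝ) 1, f (quantile μ u) = ∫ x, f x ∂μ := by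
  conv_rhs => rw [← map_quantile μ]
  rw [integral_map (aemeasurable_quantile μ)]
  rwa [map_quantile μ]

lemma integrableOn_comp_quantile [IsProbabilityMeasure μ] {f : ℝ → ℝ} (hf : Integrable f μ) :
    IntegrableOn (fun u => f (quantile μ u)) (Ioo (0 : ℝ) 1) := by
  rw [← map_quantile μ] at hf
  exact hf.comp_aemeasurable (aemeasurable_quantile μ)

lemma setIntegral_Iic_quantile [IsProbabilityMeasure μ] (hu : u ∈ Ioo (0 : ℝ) 1)
    (hcdf : cdf μ (quantile μ u) = u) :
    ∫ x in Iic (quantile μ u), x ∂μ = ∫ v in Ioo 0 u, quantile μ v := by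
  have hind : ∀ v ∈ Ioo (0 : ℝ) 1,
      (Iic (quantile μ u)).indicator id (quantile μ v) = (Iic u).indicator (quantile μ) v := by
    intro v hv
    have hiff : quantile μ v ∈ Iic (quantile μ u) ↔ v ∈ Iic u := by
      rw [mem_Iic, quantile_le_iff μ hv, hcdf, mem_Iic]
    simp only [indicator_apply, hiff, id]
  have hinter : Ioo 0 1 ∩ Iic u = Ioc 0 u := by
    ext v
    simp only [mem_inter_iff, mem_Ioo, mem_Iic, mem_Ioc]
    exact ⟨fun h => ⟨h.1.1, h.2⟩, fun h => ⟨⟨h.1, h.2.trans_lt hu.2⟩, h.2⟩⟩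
  calc ∫ x in Iic (quantile μ u), x ∂μ
      = ∫ x, (Iic (quantile μ u)).indicator id x ∂μ := (integral_indicator measurableSet_Iic).symm
    _ = ∫ v in Ioo 0 1, (Iic (quantile μ u)).indicator id (quantile μ v) :=
      (integral_quantile (measurable_id.indicator measurableSet_Iic).aestronglyMeasurable).symm
    _ = ∫ v in Ioo 0 1, (Iic u).indicator (quantile μ) v :=
      setIntegral_congr_fun measurableSet_Ioo hind
    _ = ∫ v in Ioo 0 u, quantile μ v := by
      rw [setIntegral_indicator measurableSet_Iic, hinter, integral_Ioc_eq_integral_Ioo]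

end Quantile

section SteinKernel

variable {μ : Measure ℝ} {u : ℝ}

lemma contDiffAt_quantile (hsmooth : ContDiffOn ℝ 1 (quantile μ) (Ioo 0 1))
    (hu : u ∈ Ioo (0 : ℝ) 1) : ContDiffAt ℝ 1 (quantile μ) u :=
  hsmooth.contDiffAt (Ioo_mem_nhds hu.1 hu.2)

lemma hasDerivAt_quantile (hsmooth : ContDiffOn ℝ 1 (quantile μ) (Ioo 0 1))
    (hu : u ∈ Ioo (0 : ℝ) 1) : HasDerivAt (quantile μ) (deriv (quantile μ) u) u :=
  ((contDiffAt_quantile hsmooth hu).differentiableAt one_ne_zero).hasDerivAt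

lemma cdf_quantile_of_deriv_ne_zero (hsmooth : ContDiffOn ℝ 1 (quantile μ) (Ioo 0 1))
    (hu : u ∈ Ioo (0 : ℝ) 1) (hderiv : deriv (quantile μ) u ≠ 0) :
    cdf μ (quantile μ u) = u := by
  by_contra hne
  have hlt : u < cdf μ (quantile μ u) := lt_of_le_of_ne (le_cdf_quantile μ hu.2) (Ne.symm hne)
  have hconst : quantile μ =ᶠ[𝓝[>] u] fun _ => quantile μ u := by
    filter_upwards [Ioo_mem_nhdsGT (lt_min hlt hu.2)] with v hv
    have hv' : v ∈ Ioo (0 : ℝ) 1 := ⟨hu.1.trans hv.1, hv.2.trans_le (min_le_right _ _)⟩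
    exact le_antisymm ((quantile_le_iff μ hv' _).2 (hv.2.le.trans (min_le_left _ _)))
      (monotoneOn_quantile μ hu hv' hv.1.le)
  have hzero : HasDerivWithinAt (quantile μ) 0 (Ioi u) u :=
    (hasDerivWithinAt_const u (Ioi u) (quantile μ u)).congr_of_eventuallyEq hconst rfl
  exact hderiv ((uniqueDiffWithinAt_Ioi u).eq_deriv _
    (hasDerivAt_quantile hsmooth hu).hasDerivWithinAt hzero)

lemma hasDerivAt_cdf_quantile (hsmooth : ContDiffOn ℝ 1 (quantile μ) (Ioo 0 1))
    (hu : u ∈ Ioo (0 : ℝ) 1) (hderiv : deriv (quantile μ) u ≠ 0) :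
    HasDerivAt (cdf μ) (deriv (quantile μ) u)⁻¹ (quantile μ u) := by
  have hmap : map (quantile μ) (𝓝 u) = 𝓝 (quantile μ u) :=
    ((contDiffAt_quantile hsmooth hu).hasStrictDerivAt one_ne_zero).map_nhds_eq hderiv
  have hcont : ContinuousAt (deriv (quantile μ)) u :=
    (hsmooth.continuousOn_deriv_of_isOpen isOpen_Ioo le_rfl).continuousAt (Ioo_mem_nhds hu.1 hu.2)
  have hcdf : cdf μ (quantile μ u) = u := cdf_quantile_of_deriv_ne_zero hsmooth hu hderiv
  have hinv : ∀ᶠ v in 𝓝 u, cdf μ (quantile μ v) = v := by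
    filter_upwards [hcont.eventually_ne hderiv, Ioo_mem_nhds hu.1 hu.2] with v hv hv'
    exact cdf_quantile_of_deriv_ne_zero hsmooth hv' hv
  refine HasDerivAt.of_local_left_inverse (f := quantile μ) ?_ ?_ hderiv ?_
  · rw [ContinuousAt, ← hmap, tendsto_map'_iff, hcdf]
    exact tendsto_id.congr' (hinv.mono fun v hv => hv.symm)
  · rw [hcdf]
    exact hasDerivAt_quantile hsmooth hu
  · rw [← hmap, eventually_map]
    exact hinv.mono fun v hv => by rw [hv]

lemma not_differentiableAt_cdf_quantile (hsmooth : ContDiffOn ℝ 1 (quantile μ) (Ioo 0 1))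
    (hu : u ∈ Ioo (0 : ℝ) 1) (hderiv : deriv (quantile μ) u = 0) :
    ¬ DifferentiableAt ℝ (cdf μ) (quantile μ u) := by
  intro hdiff
  have hcdf : cdf μ (quantile μ u) = u := by
    refine le_antisymm ?_ (le_cdf_quantile μ hu.2)
    refine le_of_tendsto (hdiff.continuousAt.tendsto.mono_left
      (nhdsWithin_le_nhds (s := Iio (quantile μ u)))) ?_
    filter_upwards [self_mem_nhdsWithin] with s hs
    by_contra! hlt
    exact absurd ((quantile_le_iff μ hu s).2 hlt.le) (not_le.2 hs)
  have hquantile := hasDerivAt_quantile hsmooth hu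
  rw [hderiv] at hquantile
  have hcomp := (hdiff.hasDerivAt.comp u hquantile).sub (hasDerivAt_id u)
  -- `cdf μ (quantile μ v) - v` is nonnegative with a zero at `u`, but its slope there is `-1`.
  have hmin : IsLocalMin (cdf μ ∘ quantile μ - id) u := by
    filter_upwards [Ioo_mem_nhds hu.1 hu.2] with v hv
    simp only [Pi.sub_apply, Function.comp_apply, id, hcdf, sub_self, sub_nonneg]
    exact le_cdf_quantile μ hv.2
  simpa using hmin.hasDerivAt_eq_zero hcomp

lemma steinKernel_quantile [IsProbabilityMeasure μ]
    (hsmooth : ContDiffOn ℝ 1 (quantile μ) (Ioo 0 1)) (hu : u ∈ Ioo (0 : ℝ) 1) :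
    steinKernel μ (quantile μ u) = -(∫ v in Ioo 0 u, quantile μ v) * deriv (quantile μ) u := by
  unfold steinKernel
  by_cases hderiv : deriv (quantile μ) u = 0
  · rw [deriv_zero_of_not_differentiableAt (not_differentiableAt_cdf_quantile hsmooth hu hderiv),
      hderiv]
    simp
  · rw [(hasDerivAt_cdf_quantile hsmooth hu hderiv).deriv,
      setIntegral_Iic_quantile hu (cdf_quantile_of_deriv_ne_zero hsmooth hu hderiv), one_div,
      inv_inv]
    ring

lemma measurable_setIntegral_Iic (μ : Measure ℝ) [SFinite μ] :
    Measurable fun y : ℝ => ∫ x in Iic y, x ∂μ := by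
  have hind : Measurable fun p : ℝ × ℝ => (Iic p.1).indicator id p.2 :=
    Measurable.ite (measurableSet_le measurable_snd measurable_fst) measurable_snd
      measurable_const
  have hint : StronglyMeasurable fun y : ℝ => ∫ x, (Iic y).indicator id x ∂μ :=
    StronglyMeasurable.integral_prod_right (f := fun y x : ℝ => (Iic y).indicator id x)
      hind.stronglyMeasurable
  simpa only [integral_indicator measurableSet_Iic, id] using hint.measurable

lemma measurable_steinKernel (μ : Measure ℝ) [SFinite μ] : Measurable (steinKernel μ) :=
  ((measurable_const.div (measurable_deriv _)).neg).mul (measurable_setIntegral_Iic μ)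

end SteinKernel

section SteinIdentity

lemma abs_le_add_mul_abs_of_hasDerivAt {g g' : ℝ → ℝ} {C : ℝ} (hg : ∀ x, HasDerivAt g (g' x) x)
    (hbound : ∀ x, |g' x| ≤ C) (x : ℝ) : |g x| ≤ |g 0| + C * |x| := by
  have hlip := convex_univ.norm_image_sub_le_of_norm_hasDerivWithin_le
    (fun y _ => (hg y).hasDerivWithinAt) (fun y _ => hbound y) (mem_univ 0) (mem_univ x)
  simp only [Real.norm_eq_abs, sub_zero] at hlip
  linarith [abs_sub_abs_le_abs_sub (g x) (g 0)]

lemma abs_le_add_abs_of_monotoneOn {f : ℝ → ℝ} {s : Set ℝ} (hf : MonotoneOn f s) {u v w : ℝ}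
    (hu : u ∈ s) (hv : v ∈ s) (hw : w ∈ s) (huvw : u ∈ uIcc v w) : |f u| ≤ |f v| + |f w| := by
  refine le_trans ?_ (max_le_add_of_nonneg (abs_nonneg (f v)) (abs_nonneg (f w)))
  rcases mem_uIcc.1 huvw with ⟨hvu, huw⟩ | ⟨hwu, huv⟩
  · exact abs_le_max_abs_abs (hf hv hu hvu) (hf hu hw huw)
  · rw [max_comm]
    exact abs_le_max_abs_abs (hf hw hu hwu) (hf hu hv huv)

lemma tendsto_primitive_mul_zero_of_dominated {G r b : ℝ → ℝ} {c d e : ℝ} {l : Filter ℝ}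
    (hb : IntervalIntegrable b volume d e) (hc : c ∈ uIcc d e) (hl : l ≤ 𝓝[uIcc d e] c)
    (hdom : ∀ᶠ u in l, ∀ v ∈ uIcc c u, v ≠ c → |G v * r u| ≤ b v) :
    Tendsto (fun u => (∫ v in c..u, G v) * r u) l (𝓝 0) := by
  have hprim : Tendsto (fun u => ∫ v in c..u, b v) l (𝓝 0) := by
    have hcont := (intervalIntegral.continuousOn_primitive_interval' hb hc) c hc
    simpa only [ContinuousWithinAt, intervalIntegral.integral_same] using hcont.mono_left hl
  refine squeeze_zero_norm' ?_ (abs_zero (α := ℝ) ▸ hprim.abs)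
  filter_upwards [hdom, hl self_mem_nhdsWithin] with u hu hude
  rw [← intervalIntegral.integral_mul_const]
  refine intervalIntegral.norm_integral_le_abs_of_norm_le ?_
    (hb.mono_set (uIcc_subset_uIcc hc hude))
  rw [ae_restrict_iff' measurableSet_uIoc]
  filter_upwards [compl_mem_ae_iff.2 (measure_singleton c)] with v hvc hv
  exact hu v (uIoc_subset_uIcc hv) hvc

variable {μ : Measure ℝ} [IsProbabilityMeasure μ] {g g' : ℝ → ℝ} {C : ℝ}

lemma intervalIntegrable_comp_quantile {f : ℝ → ℝ} (hf : Integrable f μ) :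
    IntervalIntegrable (fun u => f (quantile μ u)) volume 0 1 := by
  rw [intervalIntegrable_iff_integrableOn_Ioo_of_le zero_le_one]
  exact integrableOn_comp_quantile hf

lemma intervalIntegral_quantile {f : ℝ → ℝ} (hf : AEStronglyMeasurable f μ) :
    ∫ u in (0 : ℝ)..1, f (quantile μ u) = ∫ x, f x ∂μ := by
  rw [intervalIntegral.integral_of_le zero_le_one, integral_Ioc_eq_integral_Ioo,
    integral_quantile hf]

lemma integrable_mul_of_hasDerivAt_bounded (hmem : MemLp id 2 μ)
    (hg : ∀ x, HasDerivAt g (g' x) x) (hbound : ∀ x, |g' x| ≤ C) :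
    Integrable (fun x => x * g x) μ := by
  have hcont : Continuous g := continuous_iff_continuousAt.2 fun x => (hg x).continuousAt
  refine Integrable.mono' (((hmem.integrable one_le_two).abs.const_mul |g 0|).add
    (hmem.integrable_sq.const_mul C)) (by fun_prop) (ae_of_all _ fun x => ?_)
  calc ‖x * g x‖ = |x| * |g x| := abs_mul x (g x)
    _ ≤ |x| * (|g 0| + C * |x|) := by gcongr; exact abs_le_add_mul_abs_of_hasDerivAt hg hbound x
    _ = |g 0| * |x| + C * |x| ^ 2 := by ring
    _ = |g 0| * |x| + C * x ^ 2 := by rw [sq_abs]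

lemma tendsto_primitive_quantile_mul (hmem : MemLp id 2 μ)
    (hg : ∀ x, HasDerivAt g (g' x) x) (hbound : ∀ x, |g' x| ≤ C) {c : ℝ} (hc : c = 0 ∨ c = 1) :
    Tendsto (fun u => (∫ v in c..u, quantile μ v) * g (quantile μ u)) (𝓝[Ioo 0 1] c) (𝓝 0) := by
  set m := |quantile μ (1 / 2)|
  have hC : 0 ≤ C := (abs_nonneg _).trans (hbound 0)
  have hdominating : IntervalIntegrable
      (fun u => |quantile μ u| * (|g 0| + C * m) + C * quantile μ u ^ 2) volume 0 1 :=
    intervalIntegrable_comp_quantile (f := fun x => |x| * (|g 0| + C * m) + C * x ^ 2)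
      (((hmem.integrable one_le_two).abs.mul_const _).add (hmem.integrable_sq.const_mul C))
  have hcIcc : c ∈ Icc (0 : ℝ) 1 := by rcases hc with rfl | rfl <;> norm_num
  refine tendsto_primitive_mul_zero_of_dominated hdominating
    (by rwa [uIcc_of_le zero_le_one])
    (nhdsWithin_mono _ (by rw [uIcc_of_le zero_le_one]; exact Ioo_subset_Icc_self)) ?_
  filter_upwards [self_mem_nhdsWithin,
    nhdsWithin_le_nhds (Metric.ball_mem_nhds c one_half_pos)] with u hu huc v hv hvc
  rw [Real.ball_eq_Ioo] at huc
  obtain ⟨hv01, hbetween⟩ : v ∈ Ioo (0 : ℝ) 1 ∧ u ∈ uIcc v (1 / 2) := by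
    rcases hc with rfl | rfl
    · rw [uIcc_of_le hu.1.le] at hv
      exact ⟨⟨hv.1.lt_of_ne' hvc, hv.2.trans_lt hu.2⟩, mem_uIcc_of_le hv.2 (by linarith [huc.2])⟩
    · rw [uIcc_of_ge hu.2.le] at hv
      exact ⟨⟨hu.1.trans_le hv.1, hv.2.lt_of_ne hvc⟩, mem_uIcc_of_ge (by linarith [huc.1]) hv.1⟩
  have hquant : |quantile μ u| ≤ |quantile μ v| + m :=
    abs_le_add_abs_of_monotoneOn (monotoneOn_quantile μ) hu hv01 (by norm_num) hbetween
  calc |quantile μ v * g (quantile μ u)| = |quantile μ v| * |g (quantile μ u)| := abs_mul _ _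
    _ ≤ |quantile μ v| * (|g 0| + C * |quantile μ u|) := by
      gcongr
      exact abs_le_add_mul_abs_of_hasDerivAt hg hbound _
    _ ≤ |quantile μ v| * (|g 0| + C * (|quantile μ v| + m)) := by gcongr
    _ = |quantile μ v| * (|g 0| + C * m) + C * |quantile μ v| ^ 2 := by ring
    _ = |quantile μ v| * (|g 0| + C * m) + C * quantile μ v ^ 2 := by rw [sq_abs]

lemma hasDerivAt_primitive_quantile_mul (hsmooth : ContDiffOn ℝ 1 (quantile μ) (Ioo 0 1))
    (hint : Integrable id μ) (hg : ∀ x, HasDerivAt g (g' x) x) {u : ℝ}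
    (hu : u ∈ Ioo (0 : ℝ) 1) :
    HasDerivAt (fun u => (∫ v in (0 : ℝ)..u, quantile μ v) * g (quantile μ u))
      (quantile μ u * g (quantile μ u) - steinKernel μ (quantile μ u) * g' (quantile μ u)) u := by
  have hprim : HasDerivAt (fun u => ∫ v in (0 : ℝ)..u, quantile μ v) (quantile μ u) u := by
    refine intervalIntegral.integral_hasDerivAt_right
      ((intervalIntegrable_comp_quantile hint).mono_set (uIcc_subset_uIcc left_mem_uIcc ?_))
      (hsmooth.continuousOn.stronglyMeasurableAtFilter isOpen_Ioo u hu)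
      (hasDerivAt_quantile hsmooth hu).continuousAt
    exact mem_uIcc_of_le hu.1.le hu.2.le
  refine (hprim.mul ((hg _).comp u (hasDerivAt_quantile hsmooth hu))).congr_deriv ?_
  rw [steinKernel_quantile hsmooth hu, intervalIntegral.integral_of_le hu.1.le,
    integral_Ioc_eq_integral_Ioo, Function.comp_apply]
  ring

lemma primitive_quantile_eq (hint : Integrable id μ) (hmean : ∫ x, x ∂μ = 0) {u : ℝ}
    (hu : u ∈ Icc (0 : ℝ) 1) : ∫ v in (0 : ℝ)..u, quantile μ v = ∫ v in 1..u, quantile μ v := by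
  have hquant : IntervalIntegrable (quantile μ) volume 0 1 := intervalIntegrable_comp_quantile hint
  have htotal : ∫ v in (0 : ℝ)..1, quantile μ v = 0 :=
    (intervalIntegral_quantile (f := id) hint.aestronglyMeasurable).trans hmean
  rw [← intervalIntegral.integral_add_adjacent_intervals hquant
    (hquant.symm.mono_set (uIcc_subset_uIcc left_mem_uIcc (mem_uIcc_of_ge hu.1 hu.2))),
    htotal, zero_add]

theorem integral_mul_eq_integral_steinKernel_mul
    (hsmooth : ContDiffOn ℝ 1 (quantile μ) (Ioo 0 1)) (hmem : MemLp id 2 μ)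
    (hmean : ∫ x, x ∂μ = 0) (hkernel : Integrable (steinKernel μ) μ)
    (hg : ∀ x, HasDerivAt g (g' x) x) (hg' : Continuous g') (hbound : ∀ x, |g' x| ≤ C) :
    ∫ x, x * g x ∂μ = ∫ x, steinKernel μ x * g' x ∂μ := by
  have hint : Integrable id μ := hmem.integrable one_le_two
  have hxg : Integrable (fun x => x * g x) μ :=
    integrable_mul_of_hasDerivAt_bounded hmem hg hbound
  have hkg' : Integrable (fun x => steinKernel μ x * g' x) μ :=
    hkernel.mul_bdd hg'.aestronglyMeasurable (ae_of_all _ hbound)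
  have hleft := tendsto_primitive_quantile_mul hmem hg hbound (.inl rfl)
  have hright : Tendsto (fun u => (∫ v in (0 : ℝ)..u, quantile μ v) * g (quantile μ u))
      (𝓝[Ioo 0 1] 1) (𝓝 0) :=
    (tendsto_primitive_quantile_mul hmem hg hbound (.inr rfl)).congr'
      (eventually_nhdsWithin_of_forall fun u hu => by
        simp only [primitive_quantile_eq hint hmean (Ioo_subset_Icc_self hu)])
  rw [nhdsWithin_Ioo_eq_nhdsGT zero_lt_one] at hleft
  rw [nhdsWithin_Ioo_eq_nhdsLT zero_lt_one] at hright
  have hftc := intervalIntegral.integral_eq_sub_of_hasDerivAt_of_tendsto zero_lt_one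
    (fun u hu => hasDerivAt_primitive_quantile_mul hsmooth hint hg hu)
    (intervalIntegrable_comp_quantile (hxg.sub hkg')) hleft hright
  rw [intervalIntegral_quantile (f := fun x => x * g x - steinKernel μ x * g' x)
    (hxg.sub hkg').aestronglyMeasurable, integral_sub hxg hkg'] at hftc
  linarith

lemma integral_steinKernel (hsmooth : ContDiffOn ℝ 1 (quantile μ) (Ioo 0 1))
    (hmem : MemLp id 2 μ) (hmean : ∫ x, x ∂μ = 0) (hkernel : Integrable (steinKernel μ) μ) :
    ∫ x, steinKernel μ x ∂μ = ∫ x, x ^ 2 ∂μ := by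
  simpa only [mul_one, id, ← sq] using
    (integral_mul_eq_integral_steinKernel_mul hsmooth hmem hmean hkernel hasDerivAt_id
      continuous_const fun _ => abs_one.le).symm

end SteinIdentity

section Integrals

variable {α : Type*} [MeasurableSpace α] {ν : Measure α}

lemma sq_integral_mul_le {f g : α → ℝ} (hf : MemLp f 2 ν) (hg : MemLp g 2 ν) :
    (∫ x, f x * g x ∂ν) ^ 2 ≤ (∫ x, f x ^ 2 ∂ν) * ∫ x, g x ^ 2 ∂ν := by
  have hfg : Integrable (fun x => f x * g x) ν := hf.integrable_mul hg
  have hquadratic : ∀ t : ℝ, 0 ≤ (∫ x, f x ^ 2 ∂ν) * (t * t) + 2 * (∫ x, f x * g x ∂ν) * t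
      + ∫ x, g x ^ 2 ∂ν := by
    intro t
    calc 0 ≤ ∫ x, (t * f x + g x) ^ 2 ∂ν := integral_nonneg fun x => sq_nonneg _
      _ = ∫ x, ((t * t) * f x ^ 2 + 2 * t * (f x * g x) + g x ^ 2) ∂ν := by
        congr with x
        ring
      _ = (∫ x, f x ^ 2 ∂ν) * (t * t) + 2 * (∫ x, f x * g x ∂ν) * t + ∫ x, g x ^ 2 ∂ν := by
        rw [integral_add ((hf.integrable_sq.const_mul _).fun_add (hfg.const_mul _))
          hg.integrable_sq, integral_add (hf.integrable_sq.const_mul _) (hfg.const_mul _),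
          integral_const_mul, integral_const_mul]
        ring
  have hdiscrim := discrim_le_zero hquadratic
  rw [discrim] at hdiscrim
  linarith

lemma integrable_comp_of_lipschitzWith [IsFiniteMeasure ν] {K : NNReal} {h : ℝ → ℝ}
    (hh : LipschitzWith K h) {f : α → ℝ} (hf : Integrable f ν) :
    Integrable (fun x => h (f x)) ν := by
  have hshift : LipschitzWith K fun t => h t - h 0 := by
    simpa using hh.sub (LipschitzWith.const (h 0))
  have hmem := hshift.comp_memLp (by simp) (memLp_one_iff_integrable.2 hf)
  refine ((memLp_one_iff_integrable.1 hmem).add (integrable_const (h 0))).congr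
    (ae_of_all _ fun x => ?_)
  exact sub_add_cancel (h (f x)) (h 0)

end Integrals

section GaussianTail

local notation "γ" => gaussianReal 0 1
local notation "ρ" => gaussianPDFReal 0 1

lemma hasDerivAt_gaussianPDFReal (x : ℝ) : HasDerivAt ρ (-x * ρ x) x := by
  have hexponent : HasDerivAt (fun t : ℝ => -(t - 0) ^ 2 / (2 * (1 : NNReal))) (-x) x := by
    refine ((((hasDerivAt_id x).sub_const 0).pow 2).neg.div_const _).congr_deriv ?_
    simp only [id, NNReal.coe_one]
    ring
  refine (hexponent.exp.const_mul _).congr_deriv ?_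
  rw [gaussianPDFReal]
  ring

lemma continuous_gaussianPDFReal : Continuous ρ :=
  continuous_iff_continuousAt.2 fun x => (hasDerivAt_gaussianPDFReal x).continuousAt

lemma gaussianPDFReal_neg (x : ℝ) : ρ (-x) = ρ x := by simp [gaussianPDFReal]

lemma gaussianPDFReal_le_half (x : ℝ) : ρ x ≤ 1 / 2 := by
  have hsqrt : 2 ≤ √(2 * Real.pi * (1 : NNReal)) := by
    refine Real.le_sqrt_of_sq_le ?_
    rw [NNReal.coe_one]
    linarith [Real.pi_gt_three]
  have hexp : Real.exp (-(x - 0) ^ 2 / (2 * (1 : NNReal))) ≤ 1 :=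
    Real.exp_le_one_iff.2 (div_nonpos_of_nonpos_of_nonneg (neg_nonpos.2 (sq_nonneg _))
      (by positivity))
  calc ρ x ≤ 2⁻¹ * 1 := mul_le_mul (inv_anti₀ two_pos hsqrt) hexp (Real.exp_pos _).le (by norm_num)
    _ = 1 / 2 := by norm_num

lemma integrable_gaussianReal_iff {f : ℝ → ℝ} :
    Integrable f γ ↔ Integrable fun t => ρ t * f t := by
  simp only [gaussianReal_of_var_ne_zero 0 one_ne_zero, smul_eq_mul, toReal_gaussianPDF,
    integrable_withDensity_iff_integrable_smul' (measurable_gaussianPDF 0 1)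
      (ae_of_all _ fun _ => gaussianPDF_lt_top)]

lemma setIntegral_gaussianReal (f : ℝ → ℝ) {s : Set ℝ} (hs : MeasurableSet s) :
    ∫ t in s, f t ∂γ = ∫ t in s, ρ t * f t := by
  simp only [gaussianReal_of_var_ne_zero 0 one_ne_zero, smul_eq_mul, toReal_gaussianPDF,
    setIntegral_withDensity_eq_setIntegral_toReal_smul (measurable_gaussianPDF 0 1)
      (ae_of_all _ fun _ => gaussianPDF_lt_top) _ hs]

lemma measurePreserving_neg_gaussianReal : MeasurePreserving (fun t : ℝ => -t) γ γ :=
  ⟨measurable_neg, by rw [gaussianReal_map_neg, neg_zero]⟩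

lemma setIntegral_Ioi_mul_sub_deriv {f f' : ℝ → ℝ} (hf : ∀ t, HasDerivAt f (f' t) t)
    (hint : Integrable f γ) (hint' : Integrable (fun t => t * f t - f' t) γ) (x : ℝ) :
    ∫ t in Ioi x, (t * f t - f' t) ∂γ = ρ x * f x := by
  have hderiv : ∀ t, HasDerivAt (fun t => -(ρ t * f t)) (ρ t * (t * f t - f' t)) t := fun t =>
    ((hasDerivAt_gaussianPDFReal t).mul (hf t)).fun_neg.congr_deriv (by ring)
  have hderivInt := (integrable_gaussianReal_iff.1 hint').integrableOn (s := Ioi x)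
  have hlim : Tendsto (fun t => -(ρ t * f t)) atTop (𝓝 0) :=
    tendsto_zero_of_hasDerivAt_of_integrableOn_Ioi (fun t _ => hderiv t) hderivInt
      (integrable_gaussianReal_iff.1 hint).neg.integrableOn
  rw [setIntegral_gaussianReal _ measurableSet_Ioi,
    integral_Ioi_of_hasDerivAt_of_tendsto' (fun t _ => hderiv t) hderivInt hlim]
  ring

lemma integrable_id_gaussianReal : Integrable (fun t : ℝ => t) γ :=
  (memLp_id_gaussianReal' 1 ENNReal.one_ne_top).integrable le_rfl

lemma setIntegral_Ioi_id_gaussianReal (x : ℝ) : ∫ t in Ioi x, t ∂γ = ρ x := by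
  simpa using setIntegral_Ioi_mul_sub_deriv (fun t => hasDerivAt_const t (1 : ℝ))
    (integrable_const 1) (by simpa using integrable_id_gaussianReal) x

lemma setIntegral_Ioi_sq_gaussianReal (x : ℝ) :
    ∫ t in Ioi x, t ^ 2 ∂γ = x * ρ x + (γ).real (Ioi x) := by
  have hsq : Integrable (fun t : ℝ => t ^ 2) γ := (memLp_id_gaussianReal 2).integrable_sq
  have hsteinSq : Integrable (fun t : ℝ => t * id t - 1) γ := by
    simp only [id, ← sq]
    exact hsq.sub (integrable_const 1)
  have hparts := setIntegral_Ioi_mul_sub_deriv hasDerivAt_id integrable_id_gaussianReal hsteinSq x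
  simp only [id, ← sq] at hparts
  rw [integral_sub hsq.integrableOn (integrable_const 1), setIntegral_const, smul_eq_mul,
    mul_one] at hparts
  linarith

/-- The Mills ratio of the standard normal law, the tail probability divided by the density. -/
noncomputable def millsRatio (x : ℝ) : ℝ := (γ).real (Ioi x) / ρ x

lemma gaussianReal_real_Ioi (x : ℝ) : (γ).real (Ioi x) = ρ x * millsRatio x :=
  (mul_div_cancel₀ _ (gaussianPDFReal_pos 0 1 x one_ne_zero).ne').symm

lemma setIntegral_Ioi_sub_gaussianReal (x : ℝ) :
    ∫ t in Ioi x, (t - x) ∂γ = ρ x * (1 - x * millsRatio x) := by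
  rw [integral_sub integrable_id_gaussianReal.integrableOn (integrable_const x),
    setIntegral_Ioi_id_gaussianReal, setIntegral_const, gaussianReal_real_Ioi, smul_eq_mul]
  ring

lemma mul_millsRatio_le_one (x : ℝ) : x * millsRatio x ≤ 1 := by
  have hnonneg : 0 ≤ ∫ t in Ioi x, (t - x) ∂γ :=
    setIntegral_nonneg measurableSet_Ioi fun t ht => sub_nonneg.2 (le_of_lt ht)
  rw [setIntegral_Ioi_sub_gaussianReal] at hnonneg
  exact sub_nonneg.1 (nonneg_of_mul_nonneg_right hnonneg (gaussianPDFReal_pos 0 1 x one_ne_zero))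

-- Cauchy-Schwarz for `t` and `1` on the tail `(x, ∞)`.
lemma one_sub_mul_millsRatio_le_sq (x : ℝ) : 1 - x * millsRatio x ≤ millsRatio x ^ 2 := by
  have hCS := sq_integral_mul_le (ν := (γ).restrict (Ioi x)) (f := id) (g := fun _ => 1)
    ((memLp_id_gaussianReal 2).restrict _) (memLp_const 1)
  simp only [id, mul_one, setIntegral_Ioi_id_gaussianReal, setIntegral_Ioi_sq_gaussianReal,
    one_pow, setIntegral_const, smul_eq_mul, gaussianReal_real_Ioi] at hCS
  have hpos : 0 < ρ x ^ 2 := pow_pos (gaussianPDFReal_pos 0 1 x one_ne_zero) 2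
  refine le_of_mul_le_mul_left ?_ hpos
  linarith

lemma millsRatio_nonneg (x : ℝ) : 0 ≤ millsRatio x :=
  div_nonneg measureReal_nonneg (gaussianPDFReal_nonneg 0 1 x)

lemma two_mul_add_mul_one_sub_mul_millsRatio_le_one {x : ℝ} (hx : 0 ≤ x) :
    (2 * x + (1 - x * millsRatio x)) * (1 - x * millsRatio x) ≤ 1 := by
  set d := 1 - x * millsRatio x with hd
  set q := √d
  have hq : 0 ≤ q := Real.sqrt_nonneg d
  have hqd : q ^ 2 = d := Real.sq_sqrt (sub_nonneg.2 (mul_millsRatio_le_one x))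
  have hqm : q ≤ millsRatio x :=
    Real.sqrt_le_iff.2 ⟨millsRatio_nonneg x, one_sub_mul_millsRatio_le_sq x⟩
  have hxq : x * q ≤ 1 - q ^ 2 := by
    rw [hqd, hd, sub_sub_cancel]
    gcongr
  have hq1 : 0 ≤ 1 - q := by
    rw [sub_nonneg]
    refine (sq_le_one_iff₀ hq).1 ?_
    linarith [mul_nonneg hx hq]
  calc (2 * x + d) * d = 2 * q * (x * q) + q ^ 4 := by rw [← hqd]; ring
    _ ≤ 2 * q * (1 - q ^ 2) + q ^ 4 := by gcongr
    _ = 1 - (1 - q) ^ 3 * (1 + q) := by ring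
    _ ≤ 1 := sub_le_self _ (by positivity)

end GaussianTail

section SteinEquation

local notation "γ" => gaussianReal 0 1
local notation "ρ" => gaussianPDFReal 0 1

variable {k : ℝ → ℝ}

/-- The bounded solution `f` of the Stein equation `f' x - x * f x = k x`, for `k` centered under
the standard normal law. -/
noncomputable def steinSol (k : ℝ → ℝ) (x : ℝ) : ℝ := (ρ x)⁻¹ * ∫ t in Iic x, k t ∂γ

/-- The derivative of `steinSol k`, read off from the Stein equation. -/
noncomputable def steinSolDeriv (k : ℝ → ℝ) (x : ℝ) : ℝ := x * steinSol k x + k x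

lemma hasDerivAt_steinSol (hk : Continuous k) (hi : Integrable k γ) (x : ℝ) :
    HasDerivAt (steinSol k) (steinSolDeriv k x) x := by
  have hweighted := integrable_gaussianReal_iff.1 hi
  have hcont : Continuous fun t => ρ t * k t := continuous_gaussianPDFReal.mul hk
  have hprimitive : HasDerivAt (fun y => ∫ t in Iic y, k t ∂γ) (ρ x * k x) x := by
    have hinterval := (intervalIntegral.integral_hasDerivAt_right
      (hcont.intervalIntegrable x x) (hcont.stronglyMeasurableAtFilter _ _)
      hcont.continuousAt).const_add (∫ t in Iic x, ρ t * k t)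
    refine hinterval.congr_of_eventuallyEq (Eventually.of_forall fun y => ?_)
    simp only [setIntegral_gaussianReal _ measurableSet_Iic]
    rw [← intervalIntegral.integral_Iic_sub_Iic hweighted.integrableOn hweighted.integrableOn,
      add_sub_cancel]
  have hne := (gaussianPDFReal_pos 0 1 x one_ne_zero).ne'
  refine (((hasDerivAt_gaussianPDFReal x).fun_inv hne).mul hprimitive).congr_deriv ?_
  rw [steinSolDeriv, steinSol]
  field_simp

lemma continuous_steinSolDeriv (hk : Continuous k) (hi : Integrable k γ) :
    Continuous (steinSolDeriv k) :=
  (continuous_id.mul (continuous_iff_continuousAt.2 fun x =>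
    (hasDerivAt_steinSol hk hi x).continuousAt)).add hk

lemma steinSol_eq_neg (hi : Integrable k γ) (h0 : ∫ t, k t ∂γ = 0) (x : ℝ) :
    steinSol k x = -((ρ x)⁻¹ * ∫ t in Ioi x, k t ∂γ) := by
  have hsplit := intervalIntegral.integral_Iic_add_Ioi (b := x) hi.integrableOn hi.integrableOn
  rw [h0] at hsplit
  rw [steinSol, eq_neg_of_add_eq_zero_left hsplit, mul_neg]

lemma steinSolDeriv_neg (hi : Integrable k γ) (h0 : ∫ t, k t ∂γ = 0) (x : ℝ) :
    steinSolDeriv k (-x) = steinSolDeriv (fun t => k (-t)) x := by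
  have hreflect : ∫ t in Iic x, k (-t) ∂γ = ∫ t in Ioi (-x), k t ∂γ := by
    have := nullSingletonClass_gaussianReal (μ := 0) (v := 1) one_ne_zero
    rw [← integral_Ici_eq_integral_Ioi,
      ← measurePreserving_neg_gaussianReal.setIntegral_preimage_emb
        (MeasurableEquiv.neg ℝ).measurableEmbedding]
    simp
  have hneg : steinSol (fun t => k (-t)) x = -steinSol k (-x) := by
    rw [steinSol_eq_neg hi h0, neg_neg, gaussianPDFReal_neg, steinSol, hreflect]
  rw [steinSolDeriv, steinSolDeriv, hneg]
  ring

lemma integral_comp_neg_gaussianReal (f : ℝ → ℝ) : ∫ t, f (-t) ∂γ = ∫ t, f t ∂γ :=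
  measurePreserving_neg_gaussianReal.integral_comp (MeasurableEquiv.neg ℝ).measurableEmbedding f

lemma abs_steinSolDeriv_le_two_of_nonneg (hi : Integrable k γ) (hk : ∀ t, |k t| ≤ 1)
    (h0 : ∫ t, k t ∂γ = 0) {x : ℝ} (hx : 0 ≤ x) : |steinSolDeriv k x| ≤ 2 := by
  have htail : |∫ t in Ioi x, k t ∂γ| ≤ ρ x * millsRatio x := by
    rw [← gaussianReal_real_Ioi, ← one_mul ((γ).real (Ioi x))]
    exact norm_setIntegral_le_of_norm_le_const (f := k) (measure_lt_top _ _) fun t _ => hk t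
  have hmul : |x * steinSol k x| ≤ 1 := by
    have hpos := gaussianPDFReal_pos 0 1 x one_ne_zero
    rw [steinSol_eq_neg hi h0, abs_mul, abs_neg, abs_mul, abs_inv, abs_of_pos hpos,
      abs_of_nonneg hx]
    exact (mul_le_mul_of_nonneg_left ((inv_mul_le_iff₀ hpos).2 htail) hx).trans
      (mul_millsRatio_le_one x)
  calc |steinSolDeriv k x| ≤ |x * steinSol k x| + |k x| := abs_add_le _ _
    _ ≤ 2 := by linarith [hk x]

lemma abs_steinSolDeriv_le_two (hi : Integrable k γ) (hk : ∀ t, |k t| ≤ 1)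
    (h0 : ∫ t, k t ∂γ = 0) (x : ℝ) : |steinSolDeriv k x| ≤ 2 := by
  rcases le_total 0 x with hx | hx
  · exact abs_steinSolDeriv_le_two_of_nonneg hi hk h0 hx
  · rw [← neg_neg x, steinSolDeriv_neg hi h0]
    exact abs_steinSolDeriv_le_two_of_nonneg
      (measurePreserving_neg_gaussianReal.integrable_comp_of_integrable hi) (fun t => hk (-t))
      ((integral_comp_neg_gaussianReal k).trans h0) (neg_nonneg.2 hx)

lemma integrable_of_lipschitzWith_gaussianReal (hk : LipschitzWith 1 k) : Integrable k γ :=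
  integrable_comp_of_lipschitzWith hk integrable_id_gaussianReal

lemma integrable_abs_sub_gaussianReal (x : ℝ) : Integrable (fun t => |t - x|) γ :=
  (integrable_id_gaussianReal.sub (integrable_const x)).abs

lemma integral_abs_sub_gaussianReal (x : ℝ) :
    ∫ t, |t - x| ∂γ = x + 2 * (ρ x * (1 - x * millsRatio x)) := by
  have hi : Integrable (fun t => t - x) γ := integrable_id_gaussianReal.sub (integrable_const x)
  have hpointwise : ∀ t, |t - x| = 2 * (Ioi x).indicator (fun t => t - x) t - (t - x) := by
    intro t
    by_cases ht : x < t
    · rw [indicator_of_mem (mem_Ioi.2 ht), abs_of_pos (sub_pos.2 ht)]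
      ring
    · rw [indicator_of_notMem (by exact ht), abs_of_nonpos (sub_nonpos.2 (not_lt.1 ht))]
      ring
  simp only [hpointwise]
  rw [integral_sub ((hi.indicator measurableSet_Ioi).const_mul 2) hi, integral_const_mul,
    integral_indicator measurableSet_Ioi, setIntegral_Ioi_sub_gaussianReal,
    integral_sub integrable_id_gaussianReal (integrable_const x), integral_id_gaussianReal,
    integral_const, probReal_univ, one_smul]
  ring

lemma abs_setIntegral_Ioi_sub_le (hk : LipschitzWith 1 k) (x : ℝ) :
    |∫ t in Ioi x, (k t - k x) ∂γ| ≤ ρ x * (1 - x * millsRatio x) := by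
  rw [← setIntegral_Ioi_sub_gaussianReal]
  refine norm_integral_le_of_norm_le (f := fun t => k t - k x)
    (integrable_id_gaussianReal.sub (integrable_const x)).integrableOn
    (ae_restrict_of_forall_mem measurableSet_Ioi fun t ht => ?_)
  have hdist := hk.dist_le_mul t x
  rwa [NNReal.coe_one, one_mul, Real.dist_eq, Real.dist_eq,
    abs_of_pos (sub_pos.2 (mem_Ioi.1 ht))] at hdist

lemma abs_le_add_of_integral_eq_zero (hk : LipschitzWith 1 k) (h0 : ∫ t, k t ∂γ = 0) (x : ℝ) :
    |k x| ≤ x + (1 - x * millsRatio x) := by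
  have hcenter : ∫ t, (k x - k t) ∂γ = k x := by
    rw [integral_sub (integrable_const _) (integrable_of_lipschitzWith_gaussianReal hk), h0,
      integral_const, probReal_univ, one_smul, sub_zero]
  calc |k x| = ‖∫ t, (k x - k t) ∂γ‖ := by rw [hcenter, Real.norm_eq_abs]
    _ ≤ ∫ t, |t - x| ∂γ := by
      refine norm_integral_le_of_norm_le (integrable_abs_sub_gaussianReal x)
        (ae_of_all _ fun t => ?_)
      have hdist := hk.dist_le_mul x t
      rwa [NNReal.coe_one, one_mul, dist_comm x t] at hdist
    _ = x + 2 * ρ x * (1 - x * millsRatio x) := by rw [integral_abs_sub_gaussianReal, mul_assoc]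
    _ ≤ x + 1 * (1 - x * millsRatio x) := by
      have hdefect := sub_nonneg.2 (mul_millsRatio_le_one x)
      gcongr
      linarith [gaussianPDFReal_le_half x]
    _ = x + (1 - x * millsRatio x) := by rw [one_mul]

lemma abs_steinSolDeriv_le_one_of_nonneg (hk : LipschitzWith 1 k) (h0 : ∫ t, k t ∂γ = 0) {x : ℝ}
    (hx : 0 ≤ x) : |steinSolDeriv k x| ≤ 1 := by
  have hi := integrable_of_lipschitzWith_gaussianReal hk
  have hpos := gaussianPDFReal_pos 0 1 x one_ne_zero
  have hk' := abs_le_add_of_integral_eq_zero hk h0 x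
  have htail := (inv_mul_le_iff₀ hpos).2 (abs_setIntegral_Ioi_sub_le hk x)
  have hdecomp : steinSolDeriv k x
      = k x * (1 - x * millsRatio x) - x * ((ρ x)⁻¹ * ∫ t in Ioi x, (k t - k x) ∂γ) := by
    rw [integral_sub hi.integrableOn (integrable_const _), setIntegral_const, steinSolDeriv,
      steinSol_eq_neg hi h0, millsRatio, smul_eq_mul]
    ring
  have hbound := two_mul_add_mul_one_sub_mul_millsRatio_le_one hx
  set d := 1 - x * millsRatio x
  have hd : 0 ≤ d := sub_nonneg.2 (mul_millsRatio_le_one x)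
  calc |steinSolDeriv k x|
      ≤ |k x| * d + x * ((ρ x)⁻¹ * |∫ t in Ioi x, (k t - k x) ∂γ|) := by
        rw [hdecomp]
        refine (abs_sub _ _).trans_eq ?_
        rw [abs_mul, abs_mul, abs_mul, abs_of_nonneg hd, abs_of_nonneg hx, abs_inv,
          abs_of_pos hpos]
    _ ≤ (x + d) * d + x * d := by gcongr
    _ = (2 * x + d) * d := by ring
    _ ≤ 1 := hbound

lemma abs_steinSolDeriv_le_one (hk : LipschitzWith 1 k) (h0 : ∫ t, k t ∂γ = 0) (x : ℝ) :
    |steinSolDeriv k x| ≤ 1 := by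
  rcases le_total 0 x with hx | hx
  · exact abs_steinSolDeriv_le_one_of_nonneg hk h0 hx
  · rw [← neg_neg x, steinSolDeriv_neg (integrable_of_lipschitzWith_gaussianReal hk) h0]
    have hreflect : LipschitzWith 1 fun t => k (-t) := by
      simpa [Function.comp_def] using hk.comp (LipschitzWith.id (α := ℝ)).neg
    exact abs_steinSolDeriv_le_one_of_nonneg hreflect
      ((integral_comp_neg_gaussianReal k).trans h0) (neg_nonneg.2 hx)

end SteinEquation

section SteinBounds

variable {Ω : Type*} [MeasurableSpace Ω] {P : Measure Ω} {Q H : Ω → ℝ}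

/-- `H` is a Stein kernel of the random variable `Q`: `E[Q f(Q)] = E[H f'(Q)]` for every `C¹`
function `f` with bounded derivative. It need not be a function of `Q`. -/
def IsSteinKernelOf (P : Measure Ω) (Q H : Ω → ℝ) : Prop :=
  ∀ (f f' : ℝ → ℝ) (C : ℝ), (∀ x, HasDerivAt f (f' x) x) → Continuous f' → (∀ x, |f' x| ≤ C) →
    ∫ ω, Q ω * f (Q ω) ∂P = ∫ ω, H ω * f' (Q ω) ∂P

lemma integral_steinSol_discrepancy {k : ℝ → ℝ} {C : ℝ} [IsFiniteMeasure P] (hQ : Measurable Q)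
    (hH : Integrable H P) (hkernel : IsSteinKernelOf P Q H) (hk : Continuous k)
    (hkQ : Integrable (fun ω => k (Q ω)) P) (hkγ : Integrable k (gaussianReal 0 1))
    (hC : ∀ x, |steinSolDeriv k x| ≤ C) :
    ∫ ω, k (Q ω) ∂P = ∫ ω, (1 - H ω) * steinSolDeriv k (Q ω) ∂P := by
  have hcont := continuous_steinSolDeriv hk hkγ
  have hDQ : Integrable (fun ω => steinSolDeriv k (Q ω)) P :=
    Integrable.of_bound (hcont.measurable.comp hQ).aestronglyMeasurable C
      (ae_of_all _ fun ω => hC _)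
  have hsteinEq : ∀ x, steinSolDeriv k x - k x = x * steinSol k x := fun x => by
    rw [steinSolDeriv, add_sub_cancel_right]
  have hHD : Integrable (fun ω => H ω * steinSolDeriv k (Q ω)) P :=
    hH.mul_bdd hDQ.aestronglyMeasurable (ae_of_all _ fun ω => hC _)
  have hIBP := hkernel _ _ C (hasDerivAt_steinSol hk hkγ) hcont hC
  simp only [← hsteinEq] at hIBP
  rw [integral_sub hDQ hkQ] at hIBP
  simp only [sub_mul, one_mul]
  rw [integral_sub hDQ hHD, ← hIBP, sub_sub_cancel]

lemma abs_integral_comp_le_mul_integral_abs {k : ℝ → ℝ} {C : ℝ} [IsFiniteMeasure P]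
    (hQ : Measurable Q) (hH : Integrable H P) (hkernel : IsSteinKernelOf P Q H)
    (hk : Continuous k) (hkQ : Integrable (fun ω => k (Q ω)) P)
    (hkγ : Integrable k (gaussianReal 0 1)) (hC : ∀ x, |steinSolDeriv k x| ≤ C) :
    |∫ ω, k (Q ω) ∂P| ≤ C * ∫ ω, |1 - H ω| ∂P := by
  rw [integral_steinSol_discrepancy hQ hH hkernel hk hkQ hkγ hC, ← integral_const_mul]
  refine norm_integral_le_of_norm_le (f := fun ω => (1 - H ω) * steinSolDeriv k (Q ω))
    (((integrable_const 1).sub hH).abs.const_mul C) (ae_of_all _ fun ω => ?_)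
  rw [Real.norm_eq_abs, abs_mul, mul_comm]
  exact mul_le_mul_of_nonneg_right (hC _) (abs_nonneg _)

lemma integral_sub_integral_eq_zero [IsProbabilityMeasure P] (hQ : Integrable Q P) :
    ∫ ω, (Q ω - ∫ ω', Q ω' ∂P) ∂P = 0 := by
  rw [integral_sub hQ (integrable_const _), integral_const, probReal_univ, one_smul, sub_self]

lemma abs_integral_map_sub_gaussian_le {h : ℝ → ℝ} {C : ℝ} [IsProbabilityMeasure P]
    (hQ : Measurable Q) (hH : Integrable H P) (hkernel : IsSteinKernelOf P Q H)
    (hh : Continuous h) (hhQ : Integrable (fun ω => h (Q ω)) P)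
    (hhγ : Integrable h (gaussianReal 0 1))
    (hC : ∀ x, |steinSolDeriv (fun t => h t - ∫ y, h y ∂(gaussianReal 0 1)) x| ≤ C) :
    |∫ x, h x ∂(P.map Q) - ∫ x, h x ∂(gaussianReal 0 1)| ≤ C * ∫ ω, |1 - H ω| ∂P := by
  have hcenter := abs_integral_comp_le_mul_integral_abs hQ hH hkernel (hh.sub continuous_const)
    (hhQ.sub (integrable_const _)) (hhγ.sub (integrable_const _)) hC
  simp only [Pi.sub_apply] at hcenter
  rwa [integral_sub hhQ (integrable_const _), integral_const, probReal_univ, one_smul,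
    ← integral_map hQ.aemeasurable hh.aestronglyMeasurable] at hcenter

theorem wassersteinDist_gaussian_le [IsProbabilityMeasure P] (hQ : Measurable Q)
    (hQint : Integrable Q P) (hH : Integrable H P) (hkernel : IsSteinKernelOf P Q H) :
    wassersteinDist (P.map Q) (gaussianReal 0 1) ≤ ENNReal.ofReal (∫ ω, |1 - H ω| ∂P) := by
  refine iSup₂_le fun h hh => ENNReal.ofReal_le_ofReal ?_
  have hhγ := integrable_of_lipschitzWith_gaussianReal hh
  have hcentered : LipschitzWith 1 fun t => h t - ∫ y, h y ∂(gaussianReal 0 1) := by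
    simpa using hh.sub (LipschitzWith.const (∫ y, h y ∂(gaussianReal 0 1)))
  rw [← one_mul (∫ ω, |1 - H ω| ∂P)]
  exact abs_integral_map_sub_gaussian_le hQ hH hkernel hh.continuous
    (integrable_comp_of_lipschitzWith hh hQint) hhγ
    (abs_steinSolDeriv_le_one hcentered (integral_sub_integral_eq_zero hhγ))

lemma exists_continuous_mem_Icc_integral_abs_sub_le (ν : Measure ℝ) [IsFiniteMeasure ν]
    {A : Set ℝ} (hA : MeasurableSet A) {ε : ℝ} (hε : 0 < ε) :
    ∃ h : ℝ → ℝ, Continuous h ∧ (∀ x, h x ∈ Icc (0 : ℝ) 1) ∧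
      ∫ x, |A.indicator 1 x - h x| ∂ν ≤ ε := by
  have hi : Integrable (A.indicator (1 : ℝ → ℝ)) ν := (integrable_const 1).indicator hA
  obtain ⟨g, hg, hgi⟩ := hi.exists_boundedContinuous_integral_sub_le hε
  refine ⟨fun x => projIcc 0 1 zero_le_one (g x),
    continuous_subtype_val.comp ((continuous_projIcc (h := zero_le_one)).comp g.continuous),
    fun x => Subtype.coe_prop _, le_trans ?_ hg⟩
  refine integral_mono_of_nonneg (ae_of_all _ fun x => abs_nonneg _) (hi.sub hgi).norm
    (ae_of_all _ fun x => ?_)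
  have hmem : A.indicator (1 : ℝ → ℝ) x ∈ Icc (0 : ℝ) 1 :=
    ⟨indicator_nonneg (fun _ _ => zero_le_one) x, indicator_le_self' (fun _ _ => zero_le_one) x⟩
  have hfix := projIcc_of_mem zero_le_one hmem
  have hcontract := abs_projIcc_sub_projIcc (zero_le_one (α := ℝ)) (c := A.indicator 1 x) (d := g x)
  rwa [hfix] at hcontract

lemma abs_real_sub_integral_le {ν : Measure ℝ} [IsFiniteMeasure ν] {A : Set ℝ}
    (hA : MeasurableSet A) {h : ℝ → ℝ} (hh : Integrable h ν) :
    |ν.real A - ∫ x, h x ∂ν| ≤ ∫ x, |A.indicator 1 x - h x| ∂ν := by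
  have hA1 : Integrable (A.indicator (1 : ℝ → ℝ)) ν := (integrable_const 1).indicator hA
  rw [← integral_indicator_one hA, ← integral_sub hA1 hh]
  exact abs_integral_le_integral_abs

lemma abs_integral_map_sub_gaussian_le_of_mem_Icc {h : ℝ → ℝ} [IsProbabilityMeasure P]
    (hQ : Measurable Q) (hH : Integrable H P) (hkernel : IsSteinKernelOf P Q H)
    (hh : Continuous h) (h01 : ∀ x, h x ∈ Icc (0 : ℝ) 1) :
    |∫ x, h x ∂(P.map Q) - ∫ x, h x ∂(gaussianReal 0 1)| ≤ 2 * ∫ ω, |1 - H ω| ∂P := by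
  have hbound : ∀ x, ‖h x‖ ≤ 1 := fun x => abs_le.2 ⟨by linarith [(h01 x).1], (h01 x).2⟩
  have hhγ : Integrable h (gaussianReal 0 1) :=
    Integrable.of_bound hh.aestronglyMeasurable 1 (ae_of_all _ hbound)
  have hhQ : Integrable (fun ω => h (Q ω)) P :=
    Integrable.of_bound (hh.measurable.comp hQ).aestronglyMeasurable 1
      (ae_of_all _ fun ω => hbound _)
  set m := ∫ y, h y ∂(gaussianReal 0 1)
  have hm01 : m ∈ Icc (0 : ℝ) 1 :=
    (convex_Icc 0 1).integral_mem isClosed_Icc (ae_of_all _ h01) hhγ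
  exact abs_integral_map_sub_gaussian_le hQ hH hkernel hh hhQ hhγ
    (abs_steinSolDeriv_le_two (hhγ.sub (integrable_const m))
      (fun t => abs_le.2 ⟨by linarith [(h01 t).1, hm01.2], by linarith [(h01 t).2, hm01.1]⟩)
      (integral_sub_integral_eq_zero hhγ))

theorem totalVariationDist_gaussian_le [IsProbabilityMeasure P] (hQ : Measurable Q)
    (hH : Integrable H P) (hkernel : IsSteinKernelOf P Q H) :
    totalVariationDist (P.map Q) (gaussianReal 0 1) ≤ ENNReal.ofReal (2 * ∫ ω, |1 - H ω| ∂P) := by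
  refine iSup₂_le fun A hA => ENNReal.ofReal_le_ofReal ?_
  refine le_of_forall_pos_le_add fun ε hε => ?_
  have := Measure.isProbabilityMeasure_map (μ := P) hQ.aemeasurable
  obtain ⟨h, hcont, h01, happrox⟩ :=
    exists_continuous_mem_Icc_integral_abs_sub_le (P.map Q + gaussianReal 0 1) hA hε
  have hbound : ∀ x, ‖h x‖ ≤ 1 := fun x => abs_le.2 ⟨by linarith [(h01 x).1], (h01 x).2⟩
  have hint (ν : Measure ℝ) [IsFiniteMeasure ν] : Integrable h ν :=
    Integrable.of_bound hcont.aestronglyMeasurable 1 (ae_of_all _ hbound)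
  have herror (ν : Measure ℝ) [IsFiniteMeasure ν] :
      Integrable (fun x => |A.indicator 1 x - h x|) ν :=
    (((integrable_const 1).indicator hA).sub (hint ν)).abs
  rw [integral_add_measure (herror _) (herror _)] at happrox
  have hQerror := abs_real_sub_integral_le hA (hint (P.map Q))
  have hγerror := abs_real_sub_integral_le hA (hint (gaussianReal 0 1))
  have hstein := abs_integral_map_sub_gaussian_le_of_mem_Icc hQ hH hkernel hcont h01
  rw [abs_le] at hQerror hγerror hstein ⊢
  constructor <;> linarith [hQerror.1, hQerror.2, hγerror.1, hγerror.2, hstein.1, hstein.2]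

end SteinBounds

end SteinQuadForm

namespace SteinQuadForm

open Function Finset Matrix

section Resampling

variable {ι : Type*} [Fintype ι] [DecidableEq ι] {α : ι → Type*} [∀ i, MeasurableSpace (α i)]
  {μ : ∀ i, Measure (α i)} [∀ i, SigmaFinite (μ i)] {i : ι} [IsProbabilityMeasure (μ i)]

variable (μ i) in
lemma measurePreserving_update :
    MeasurePreserving (fun p : (∀ j, α j) × α i => update p.1 i p.2)
      ((Measure.pi μ).prod (μ i)) (Measure.pi μ) := by
  refine ⟨measurable_update', (Measure.pi_eq fun s hs => ?_).symm⟩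
  rw [Measure.map_apply measurable_update' (MeasurableSet.univ_pi hs)]
  have hpreimage : (fun p : (∀ j, α j) × α i => update p.1 i p.2) ⁻¹' Set.univ.pi s
      = (Set.univ.pi (update s i Set.univ)) ×ˢ s i := by
    ext p
    simp only [Set.mem_preimage, Set.mem_univ_pi, Set.mem_prod, forall_update_iff p.1
      (fun j y => y ∈ s j), forall_update_iff s (fun j t => p.1 j ∈ t), Set.mem_univ, true_and]
    exact and_comm
  rw [hpreimage, Measure.prod_prod, Measure.pi_pi, ← mul_prod_erase univ _ (mem_univ i),
    ← mul_prod_erase univ (fun j => μ j (s j)) (mem_univ i), update_self, measure_univ, one_mul,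
    mul_comm]
  congr 1
  exact prod_congr rfl fun j hj => by rw [update_of_ne (ne_of_mem_erase hj)]

variable {F : (∀ j, α j) → ℝ}

lemma integral_eq_integral_update (hF : Integrable F (Measure.pi μ)) :
    ∫ x, F x ∂Measure.pi μ = ∫ x, ∫ z, F (update x i z) ∂μ i ∂Measure.pi μ := by
  have hmp := measurePreserving_update μ i
  calc ∫ x, F x ∂Measure.pi μ
      = ∫ p, F (update p.1 i p.2) ∂(Measure.pi μ).prod (μ i) := by
        rw [← integral_map hmp.measurable.aemeasurable
          (by rw [hmp.map_eq]; exact hF.aestronglyMeasurable), hmp.map_eq]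
    _ = ∫ x, ∫ z, F (update x i z) ∂μ i ∂Measure.pi μ :=
        integral_prod _ (hmp.integrable_comp_of_integrable hF)

lemma integrable_integral_update (hF : Integrable F (Measure.pi μ)) :
    Integrable (fun x => ∫ z, F (update x i z) ∂μ i) (Measure.pi μ) :=
  ((measurePreserving_update μ i).integrable_comp_of_integrable hF).integral_prod_left

variable {g : α i → ℝ} {G : (∀ j, α j) → ℝ}

lemma integrable_mul_of_update_invariant (hg : Integrable g (μ i))
    (hG : Integrable G (Measure.pi μ)) (hinv : ∀ x z, G (update x i z) = G x) :
    Integrable (fun x => g (x i) * G x) (Measure.pi μ) := by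
  have hmp := measurePreserving_update μ i
  have hmeas : AEStronglyMeasurable (fun x => g (x i) * G x) (Measure.pi μ) :=
    (hg.aestronglyMeasurable.comp_quasiMeasurePreserving
      (Measure.quasiMeasurePreserving_eval μ i)).mul hG.aestronglyMeasurable
  rw [← hmp.integrable_comp hmeas]
  refine (hG.mul_prod hg).congr (ae_of_all _ fun p => ?_)
  simp only [Function.comp_apply, update_self, hinv, mul_comm]

lemma integral_mul_of_update_invariant (hg : Integrable g (μ i))
    (hG : Integrable G (Measure.pi μ)) (hinv : ∀ x z, G (update x i z) = G x) :
    ∫ x, g (x i) * G x ∂Measure.pi μ = (∫ z, g z ∂μ i) * ∫ x, G x ∂Measure.pi μ := by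
  rw [integral_eq_integral_update (i := i) (integrable_mul_of_update_invariant hg hG hinv)]
  simp only [update_self, hinv, integral_mul_const, integral_const_mul]

end Resampling

section Moments

/-- The law `μ` is centered with unit variance and a finite fourth moment. -/
structure IsStandardized (μ : Measure ℝ) : Prop where
  integral_id : ∫ x, x ∂μ = 0
  integral_sq : ∫ x, x ^ 2 ∂μ = 1
  integrable_pow_four : Integrable (fun x => x ^ 4) μ

/-- The quadratic form with matrix `a`, as a function of its variables. -/
def quadFun {ι : Type*} [Fintype ι] (a : Matrix ι ι ℝ) (x : ι → ℝ) : ℝ := x ⬝ᵥ a *ᵥ x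

variable {ι : Type*} [Fintype ι]

lemma quadFun_eq_sum (a : Matrix ι ι ℝ) (x : ι → ℝ) :
    quadFun a x = ∑ k, ∑ l, a k l * (x k * x l) := by
  simp only [quadFun, dotProduct, mulVec, mul_sum]
  exact sum_congr rfl fun k _ => sum_congr rfl fun l _ => by ring

lemma measurable_quadFun (a : Matrix ι ι ℝ) : Measurable (quadFun a) := by
  simp only [funext (quadFun_eq_sum a)]
  fun_prop

lemma sum_mul_mul_wick [DecidableEq ι] {a : Matrix ι ι ℝ} (ha : a.IsSymm) (κ : ℝ) :
    ∑ k, ∑ l, ∑ i, ∑ j, a k l * a i j * ((if k = l ∧ i = j then 1 else 0)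
        + (if k = i ∧ l = j then 1 else 0) + (if k = j ∧ l = i then 1 else 0)
        + if k = l ∧ k = i ∧ k = j then κ else 0)
      = a.trace ^ 2 + 2 * (∑ k, ∑ l, a k l ^ 2) + κ * ∑ k, a k k ^ 2 := by
  have htrace : ∑ k, ∑ l, ∑ i, ∑ j, (if k = l ∧ i = j then a k l * a i j else 0)
      = a.trace ^ 2 := by
    simp [ite_and, sq, trace, sum_mul_sum, sum_ite_irrel]
  have hsq : ∑ k, ∑ l, ∑ i, ∑ j, (if k = i ∧ l = j then a k l * a i j else 0)
      = ∑ k, ∑ l, a k l ^ 2 := by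
    simp [ite_and, sq, sum_ite_irrel]
  have hswap : ∑ k, ∑ l, ∑ i, ∑ j, (if k = j ∧ l = i then a k l * a i j else 0)
      = ∑ k, ∑ l, a k l ^ 2 := by
    simp [ite_and, sq, ha.apply]
  have hdiag : ∑ k, ∑ l, ∑ i, ∑ j, (if k = l ∧ k = i ∧ k = j then a k l * a i j * κ else 0)
      = κ * ∑ k, a k k ^ 2 := by
    simp [ite_and, sq, sum_ite_irrel, mul_sum, mul_comm]
  simp only [mul_add, sum_add_distrib, mul_ite, mul_one, mul_zero, htrace, hsq, hswap, hdiag]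
  ring

namespace IsStandardized

variable {μ : Measure ℝ}

lemma memLp_sq (h : IsStandardized μ) : MemLp (fun x => x ^ 2) 2 μ := by
  rw [memLp_two_iff_integrable_sq (by fun_prop)]
  simpa only [← pow_mul] using h.integrable_pow_four

variable [IsProbabilityMeasure μ]

lemma memLp_id (h : IsStandardized μ) : MemLp id 2 μ :=
  (memLp_two_iff_integrable_sq aestronglyMeasurable_id).2 (h.memLp_sq.integrable one_le_two)

lemma one_le_integral_pow_four (h : IsStandardized μ) : 1 ≤ ∫ x, x ^ 4 ∂μ := by
  have hcs := sq_integral_mul_le h.memLp_sq (memLp_const (1 : ℝ))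
  simpa [← pow_mul, h.integral_sq] using hcs

lemma memLp_apply (h : IsStandardized μ) (a : ι) :
    MemLp (fun x : ι → ℝ => x a) 2 (Measure.pi fun _ => μ) :=
  h.memLp_id.comp_measurePreserving (measurePreserving_eval (fun _ : ι => μ) a)

lemma memLp_mul (h : IsStandardized μ) (a b : ι) :
    MemLp (fun x : ι → ℝ => x a * x b) 2 (Measure.pi fun _ => μ) := by
  have hsq (i : ι) : MemLp (fun x : ι → ℝ => x i ^ 2) 2 (Measure.pi fun _ => μ) :=
    h.memLp_sq.comp_measurePreserving (measurePreserving_eval (fun _ : ι => μ) i)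
  rw [memLp_two_iff_integrable_sq (by fun_prop)]
  simp only [mul_pow]
  exact (hsq a).integrable_mul (hsq b)

lemma memLp_quadFun (h : IsStandardized μ) (a : Matrix ι ι ℝ) :
    MemLp (quadFun a) 2 (Measure.pi fun _ => μ) := by
  simp only [funext (quadFun_eq_sum a)]
  exact memLp_finsetSum _ fun k _ => memLp_finsetSum _ fun l _ => (h.memLp_mul k l).const_mul _

lemma integrable_mul_mul_mul (h : IsStandardized μ) (a b c d : ι) :
    Integrable (fun x : ι → ℝ => x a * x b * (x c * x d)) (Measure.pi fun _ => μ) :=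
  (h.memLp_mul a b).integrable_mul (h.memLp_mul c d)

lemma integral_apply (h : IsStandardized μ) (a : ι) :
    ∫ x : ι → ℝ, x a ∂(Measure.pi fun _ => μ) = 0 :=
  integral_eval.trans h.integral_id

lemma integral_mul [DecidableEq ι] (h : IsStandardized μ) (a b : ι) :
    ∫ x : ι → ℝ, x a * x b ∂(Measure.pi fun _ => μ) = if a = b then 1 else 0 := by
  split_ifs with hab
  · subst hab
    simp only [← sq]
    rw [integral_comp_eval (μ := fun _ : ι => μ) (f := fun z : ℝ => z ^ 2) (by fun_prop),
      h.integral_sq]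
  · rw [integral_mul_of_update_invariant (μ := fun _ => μ) (i := a) (g := fun z => z)
      (h.memLp_id.integrable one_le_two) ((h.memLp_apply b).integrable one_le_two)
      fun x z => update_of_ne (Ne.symm hab) _ _, h.integral_id, zero_mul]

lemma integral_sq_mul_sq (h : IsStandardized μ) {a b : ι} (hab : a ≠ b) :
    ∫ x : ι → ℝ, x a * x a * (x b * x b) ∂(Measure.pi fun _ => μ) = 1 := by
  classical
  have hsq : Integrable (fun z => z * z) μ := by
    simpa only [sq] using h.memLp_sq.integrable one_le_two
  rw [integral_mul_of_update_invariant (μ := fun _ => μ) (i := a) (g := fun z => z * z) hsq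
      ((h.memLp_mul b b).integrable one_le_two) fun x z => by rw [update_of_ne hab.symm],
    h.integral_mul, if_pos rfl, mul_one]
  simpa only [sq] using h.integral_sq

lemma integral_mul_mul_mul_of_ne (h : IsStandardized μ) {a b c d : ι} (hb : a ≠ b)
    (hc : a ≠ c) (hd : a ≠ d) :
    ∫ x : ι → ℝ, x a * x b * (x c * x d) ∂(Measure.pi fun _ => μ) = 0 := by
  classical
  simp only [mul_assoc (_ : ℝ) _ (_ * _)]
  rw [integral_mul_of_update_invariant (μ := fun _ => μ) (i := a) (g := fun z => z)
    (G := fun x => x b * (x c * x d)) (h.memLp_id.integrable one_le_two)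
    ((h.memLp_apply b).integrable_mul (h.memLp_mul c d))
    fun x z => by rw [update_of_ne hb.symm, update_of_ne hc.symm, update_of_ne hd.symm],
    h.integral_id, zero_mul]

/-- Wick's formula, with the fourth cumulant as correction on the diagonal. -/
lemma integral_mul_mul_mul [DecidableEq ι] (h : IsStandardized μ) (a b c d : ι) :
    ∫ x : ι → ℝ, x a * x b * (x c * x d) ∂(Measure.pi fun _ => μ)
      = (if a = b ∧ c = d then 1 else 0) + (if a = c ∧ b = d then 1 else 0)
        + (if a = d ∧ b = c then 1 else 0)
        + if a = b ∧ a = c ∧ a = d then (∫ x, x ^ 4 ∂μ) - 3 else 0 := by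
  by_cases hab : a = b
  · subst hab
    by_cases hcd : c = d
    · subst hcd
      by_cases hac : a = c
      · subst hac
        have hfour : ∀ x : ι → ℝ, x a * x a * (x a * x a) = x a ^ 4 := fun x => by ring
        simp only [hfour]
        rw [integral_comp_eval (μ := fun _ : ι => μ) (f := fun z : ℝ => z ^ 4) (by fun_prop)]
        simp only [and_self, if_true]
        ring
      · rw [h.integral_sq_mul_sq hac]
        simp [hac]
    · by_cases hac : a = c
      · subst hac
        have hzero := h.integral_mul_mul_mul_of_ne (Ne.symm hcd) (Ne.symm hcd) (Ne.symm hcd)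
        simpa [hcd, mul_comm, mul_left_comm] using hzero
      · have hzero := h.integral_mul_mul_mul_of_ne (Ne.symm hac) (Ne.symm hac) hcd
        simpa [hac, hcd, mul_comm, mul_left_comm] using hzero
  · by_cases hac : a = c
    · subst hac
      by_cases hbd : b = d
      · subst hbd
        have hone := h.integral_sq_mul_sq hab
        simpa [hab, mul_comm, mul_left_comm] using hone
      · have hzero := h.integral_mul_mul_mul_of_ne (Ne.symm hab) (Ne.symm hab) hbd
        simpa [hab, hbd, Ne.symm hab, mul_comm, mul_left_comm] using hzero
    · by_cases had : a = d
      · subst had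
        by_cases hbc : b = c
        · subst hbc
          have hone := h.integral_sq_mul_sq hab
          simpa [hab, mul_comm, mul_left_comm] using hone
        · have hzero := h.integral_mul_mul_mul_of_ne (Ne.symm hab) (Ne.symm hab) hbc
          simpa [hab, hac, hbc, mul_comm, mul_left_comm] using hzero
      · rw [h.integral_mul_mul_mul_of_ne hab hac had]
        simp [hab, hac, had]

lemma integral_quadFun (h : IsStandardized μ) (a : Matrix ι ι ℝ) :
    ∫ x, quadFun a x ∂(Measure.pi fun _ => μ) = a.trace := by
  classical
  have hint (k l : ι) : Integrable (fun x : ι → ℝ => a k l * (x k * x l))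
      (Measure.pi fun _ => μ) := ((h.memLp_mul k l).integrable one_le_two).const_mul _
  simp only [quadFun_eq_sum]
  rw [integral_finsetSum _ fun k _ => integrable_finsetSum _ fun l _ => hint k l]
  simp only [integral_finsetSum _ fun l _ => hint _ l, integral_const_mul, h.integral_mul, mul_ite,
    mul_one, mul_zero, sum_ite_eq, mem_univ, if_true, trace, Matrix.diag_apply]

lemma integral_quadFun_sq (h : IsStandardized μ) {a : Matrix ι ι ℝ} (ha : a.IsSymm) :
    ∫ x, quadFun a x ^ 2 ∂(Measure.pi fun _ => μ)
      = a.trace ^ 2 + 2 * (∑ k, ∑ l, a k l ^ 2) + ((∫ x, x ^ 4 ∂μ) - 3) * ∑ k, a k k ^ 2 := by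
  classical
  have hint (k l i j : ι) : Integrable
      (fun x : ι → ℝ => a k l * a i j * (x k * x l * (x i * x j))) (Measure.pi fun _ => μ) :=
    (h.integrable_mul_mul_mul k l i j).const_mul _
  have hexpand (x : ι → ℝ) : quadFun a x ^ 2
      = ∑ k, ∑ l, ∑ i, ∑ j, a k l * a i j * (x k * x l * (x i * x j)) := by
    simp only [quadFun_eq_sum, sq, sum_mul]
    refine sum_congr rfl fun k _ => sum_congr rfl fun l _ => ?_
    simp only [mul_sum, mul_mul_mul_comm]
  simp only [hexpand]
  rw [integral_finsetSum _ fun k _ => integrable_finsetSum _ fun l _ =>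
    integrable_finsetSum _ fun i _ => integrable_finsetSum _ fun j _ => hint k l i j]
  simp only [integral_finsetSum _ fun l _ => integrable_finsetSum _ fun i _ =>
      integrable_finsetSum _ fun j _ => hint _ l i j,
    integral_finsetSum _ fun i _ => integrable_finsetSum _ fun j _ => hint _ _ i j,
    integral_finsetSum _ fun j _ => hint _ _ _ j, integral_const_mul, h.integral_mul_mul_mul]
  exact sum_mul_mul_wick ha _

end IsStandardized

end Moments

section LinearForms

variable {ι : Type*} [Fintype ι]

lemma dotProduct_update [DecidableEq ι] (b x : ι → ℝ) (i : ι) (z : ℝ) :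
    b ⬝ᵥ update x i z = update b i 0 ⬝ᵥ x + b i * z := by
  simp only [dotProduct, ← add_sum_erase univ _ (mem_univ i), update_self, zero_mul, zero_add]
  rw [add_comm]
  congr 1
  exact sum_congr rfl fun l hl => by
    rw [update_of_ne (ne_of_mem_erase hl), update_of_ne (ne_of_mem_erase hl)]

lemma dotProduct_update_of_eq_zero [DecidableEq ι] {b : ι → ℝ} {i : ι} (hb : b i = 0)
    (x : ι → ℝ) (z : ℝ) : b ⬝ᵥ update x i z = b ⬝ᵥ x := by
  rw [dotProduct_update, hb, zero_mul, add_zero, update_eq_self_iff.2 hb.symm]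

lemma dotProduct_mul_dotProduct (b d x : ι → ℝ) :
    (b ⬝ᵥ x) * (d ⬝ᵥ x) = quadFun (vecMulVec b d) x := by
  simp only [quadFun_eq_sum, dotProduct, sum_mul_sum, vecMulVec_apply, mul_mul_mul_comm]

lemma quadFun_transpose_mul_self (a : Matrix ι ι ℝ) (x : ι → ℝ) :
    quadFun (aᵀ * a) x = ∑ k, (a k ⬝ᵥ x) ^ 2 := by
  rw [quadFun, ← mulVec_mulVec, dotProduct_transpose_mulVec]
  simp only [dotProduct, mulVec, sq]

lemma quadFun_update [DecidableEq ι] {a : Matrix ι ι ℝ} (ha : a.IsSymm) (hdiag : ∀ k, a k k = 0)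
    (x : ι → ℝ) (k : ι) (z : ℝ) :
    quadFun a (update x k z) = quadFun a x - 2 * (a k ⬝ᵥ x) * x k + 2 * (a k ⬝ᵥ x) * z := by
  have hupdate : update x k z = x + Pi.single k (z - x k) := by
    ext l
    rcases eq_or_ne l k with rfl | hl
    · simp
    · simp [hl]
  have hrow : x ⬝ᵥ a *ᵥ Pi.single k (z - x k) = (a k ⬝ᵥ x) * (z - x k) := by
    rw [← ha.eq, dotProduct_transpose_mulVec, single_dotProduct, ha.eq, mulVec, mul_comm]
  have hcol : Pi.single k (z - x k) ⬝ᵥ a *ᵥ x = (a k ⬝ᵥ x) * (z - x k) := by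
    rw [single_dotProduct, mulVec, mul_comm]
  have hcorner : Pi.single k (z - x k) ⬝ᵥ a *ᵥ Pi.single k (z - x k) = 0 := by
    simp [single_dotProduct, hdiag]
  rw [quadFun, hupdate, mulVec_add, add_dotProduct, dotProduct_add, dotProduct_add, hrow, hcol,
    hcorner, quadFun]
  ring

namespace IsStandardized

variable {μ : Measure ℝ} [IsProbabilityMeasure μ]

lemma memLp_dotProduct (h : IsStandardized μ) (b : ι → ℝ) :
    MemLp (fun x => b ⬝ᵥ x) 2 (Measure.pi fun _ => μ) :=
  memLp_finsetSum _ fun l _ => (h.memLp_apply l).const_mul _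

lemma memLp_dotProduct_sq (h : IsStandardized μ) (b : ι → ℝ) :
    MemLp (fun x => (b ⬝ᵥ x) ^ 2) 2 (Measure.pi fun _ => μ) := by
  simp only [sq, dotProduct_mul_dotProduct]
  exact h.memLp_quadFun _

lemma integral_dotProduct (h : IsStandardized μ) (b : ι → ℝ) :
    ∫ x, b ⬝ᵥ x ∂(Measure.pi fun _ => μ) = 0 := by
  simp only [dotProduct]
  rw [integral_finsetSum _ fun l _ => ((h.memLp_apply l).integrable one_le_two).const_mul _]
  simp only [integral_const_mul, h.integral_apply, mul_zero, sum_const_zero]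

lemma integral_dotProduct_mul_dotProduct (h : IsStandardized μ) (b d : ι → ℝ) :
    ∫ x, (b ⬝ᵥ x) * (d ⬝ᵥ x) ∂(Measure.pi fun _ => μ) = b ⬝ᵥ d := by
  simp only [dotProduct_mul_dotProduct, h.integral_quadFun, trace_vecMulVec]

lemma integral_dotProduct_sq_sq_le (h : IsStandardized μ) (b : ι → ℝ) :
    ∫ x, ((b ⬝ᵥ x) ^ 2) ^ 2 ∂(Measure.pi fun _ => μ)
      ≤ (2 + ∫ x, x ^ 4 ∂μ) * (∑ l, b l ^ 2) ^ 2 := by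
  have hsymm : (vecMulVec b b).IsSymm := IsSymm.ext fun k l => mul_comm _ _
  have htrace : (vecMulVec b b).trace = ∑ l, b l ^ 2 := by
    simp only [trace_vecMulVec, dotProduct, sq]
  have hfrob : ∑ k, ∑ l, vecMulVec b b k l ^ 2 = (∑ l, b l ^ 2) ^ 2 := by
    simp only [vecMulVec_apply, mul_pow, sq (∑ l, b l ^ 2), sum_mul_sum]
  have hdiag : ∑ k, vecMulVec b b k k ^ 2 ≤ (∑ l, b l ^ 2) ^ 2 := by
    rw [← hfrob]
    exact sum_le_sum fun k _ => single_le_sum (f := fun l => vecMulVec b b k l ^ 2)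
      (fun _ _ => sq_nonneg _) (mem_univ k)
  have hdiag_nonneg : 0 ≤ ∑ k, vecMulVec b b k k ^ 2 := sum_nonneg fun _ _ => sq_nonneg _
  simp only [sq (b ⬝ᵥ _), dotProduct_mul_dotProduct]
  rw [h.integral_quadFun_sq hsymm, htrace, hfrob]
  nlinarith [mul_le_mul_of_nonneg_left hdiag (sub_nonneg.2 h.one_le_integral_pow_four)]

lemma integral_quadFun_sub_trace_sq (h : IsStandardized μ) {a : Matrix ι ι ℝ} (ha : a.IsSymm) :
    ∫ x, (quadFun a x - a.trace) ^ 2 ∂(Measure.pi fun _ => μ)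
      = 2 * (∑ k, ∑ l, a k l ^ 2) + ((∫ x, x ^ 4 ∂μ) - 3) * ∑ k, a k k ^ 2 := by
  have hsq := (h.memLp_quadFun a).integrable_sq
  have hint := ((h.memLp_quadFun a).integrable one_le_two).const_mul (2 * a.trace)
  have hsub : Integrable (fun x => quadFun a x ^ 2 - 2 * a.trace * quadFun a x)
      (Measure.pi fun _ => μ) := hsq.sub hint
  have hexpand (x : ι → ℝ) : (quadFun a x - a.trace) ^ 2
      = quadFun a x ^ 2 - 2 * a.trace * quadFun a x + a.trace ^ 2 := by ring
  simp only [hexpand]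
  rw [integral_add hsub (integrable_const _), integral_sub hsq hint, integral_const_mul,
    h.integral_quadFun, h.integral_quadFun_sq ha, integral_const, probReal_univ, one_smul]
  ring

end IsStandardized

end LinearForms

section SteinKernelOfQuadFun

variable {ι : Type*} [Fintype ι]

/-- The Stein kernel of the quadratic form with matrix `a` in independent variables with Stein
kernel `φ`: `2 ∑ φ(x_k) T_k²` with `T_k = ∑ a_{k,l} x_l`. -/
def quadKernel (φ : ℝ → ℝ) (a : Matrix ι ι ℝ) (x : ι → ℝ) : ℝ :=
  2 * ∑ k, φ (x k) * (a k ⬝ᵥ x) ^ 2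

variable {μ : Measure ℝ} [IsProbabilityMeasure μ] {φ : ℝ → ℝ} {a : Matrix ι ι ℝ}
  {f f' : ℝ → ℝ} {C : ℝ}

lemma memLp_comp_of_hasDerivAt_bounded {α : Type*} [MeasurableSpace α] {P : Measure α}
    [IsFiniteMeasure P] {Q : α → ℝ} {p : ℝ≥0∞} (hQ : MemLp Q p P) (hf : ∀ x, HasDerivAt f (f' x) x)
    (hC : ∀ x, |f' x| ≤ C) : MemLp (fun ω => f (Q ω)) p P := by
  have hcont : Continuous f := continuous_iff_continuousAt.2 fun x => (hf x).continuousAt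
  exact ((memLp_const |f 0|).add (hQ.norm.const_mul C)).mono'
    (hcont.comp_aestronglyMeasurable hQ.aestronglyMeasurable)
    (ae_of_all _ fun ω => abs_le_add_mul_abs_of_hasDerivAt hf hC _)

lemma integrable_mul_dotProduct_sq (h : IsStandardized μ) (hφ : Integrable φ μ) {b : ι → ℝ}
    {k : ι} (hb : b k = 0) :
    Integrable (fun x : ι → ℝ => φ (x k) * (b ⬝ᵥ x) ^ 2) (Measure.pi fun _ => μ) := by
  classical
  exact integrable_mul_of_update_invariant (μ := fun _ => μ) hφ
    ((h.memLp_dotProduct_sq b).integrable one_le_two)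
    fun x z => by rw [dotProduct_update_of_eq_zero hb]

lemma integral_mul_comp_affine (h : IsStandardized μ)
    (hsmooth : ContDiffOn ℝ 1 (quantile μ) (Set.Ioo 0 1)) (hφ : Integrable (steinKernel μ) μ)
    (hf : ∀ x, HasDerivAt f (f' x) x) (hf' : Continuous f') (hC : ∀ x, |f' x| ≤ C) (u v : ℝ) :
    ∫ z, z * f (u + v * z) ∂μ = ∫ z, steinKernel μ z * (f' (u + v * z) * v) ∂μ := by
  have hderiv (z : ℝ) : HasDerivAt (fun z => f (u + v * z)) (f' (u + v * z) * v) z := by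
    have haffine := ((hasDerivAt_id z).const_mul v).const_add u
    rw [mul_one] at haffine
    exact (hf _).comp z haffine
  refine integral_mul_eq_integral_steinKernel_mul (C := C * |v|) hsmooth h.memLp_id h.integral_id
    hφ hderiv (by fun_prop) fun z => ?_
  rw [abs_mul]
  exact mul_le_mul_of_nonneg_right (hC _) (abs_nonneg _)

lemma integrable_mul_dotProduct_mul_comp (h : IsStandardized μ) (hdiag : ∀ k, a k k = 0)
    (hf : ∀ x, HasDerivAt f (f' x) x) (hC : ∀ x, |f' x| ≤ C) (k : ι) :
    Integrable (fun x => x k * (a k ⬝ᵥ x) * f (quadFun a x)) (Measure.pi fun _ => μ) := by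
  have hmemLp : MemLp (fun x : ι → ℝ => x k * (a k ⬝ᵥ x)) 2 (Measure.pi fun _ => μ) := by
    have hmeas : AEStronglyMeasurable (fun x : ι → ℝ => x k * (a k ⬝ᵥ x))
        (Measure.pi fun _ => μ) :=
      (h.memLp_apply k).aestronglyMeasurable.mul (h.memLp_dotProduct _).aestronglyMeasurable
    rw [memLp_two_iff_integrable_sq hmeas]
    simp only [mul_pow]
    exact integrable_mul_dotProduct_sq h (φ := fun z => z ^ 2) (h.memLp_sq.integrable one_le_two)
      (hdiag k)
  exact hmemLp.integrable_mul (memLp_comp_of_hasDerivAt_bounded (h.memLp_quadFun a) hf hC)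

lemma integrable_mul_dotProduct_sq_mul_comp (h : IsStandardized μ) (hφ : Integrable φ μ)
    (hdiag : ∀ k, a k k = 0) (hf' : Continuous f') (hC : ∀ x, |f' x| ≤ C) (k : ι) :
    Integrable (fun x => φ (x k) * (a k ⬝ᵥ x) ^ 2 * f' (quadFun a x)) (Measure.pi fun _ => μ) :=
  (integrable_mul_dotProduct_sq h hφ (hdiag k)).mul_bdd
    (hf'.measurable.comp (measurable_quadFun a)).aestronglyMeasurable (ae_of_all _ fun _ => hC _)

lemma integral_mul_dotProduct_mul_comp (h : IsStandardized μ)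
    (hsmooth : ContDiffOn ℝ 1 (quantile μ) (Set.Ioo 0 1)) (hφ : Integrable (steinKernel μ) μ)
    (ha : a.IsSymm) (hdiag : ∀ k, a k k = 0) (hf : ∀ x, HasDerivAt f (f' x) x)
    (hf' : Continuous f') (hC : ∀ x, |f' x| ≤ C) (k : ι) :
    ∫ x, x k * (a k ⬝ᵥ x) * f (quadFun a x) ∂(Measure.pi fun _ => μ)
      = 2 * ∫ x, steinKernel μ (x k) * (a k ⬝ᵥ x) ^ 2 * f' (quadFun a x)
        ∂(Measure.pi fun _ => μ) := by
  classical
  rw [integral_eq_integral_update (i := k) (integrable_mul_dotProduct_mul_comp h hdiag hf hC k),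
    integral_eq_integral_update (i := k)
      (integrable_mul_dotProduct_sq_mul_comp h hφ hdiag hf' hC k), ← integral_const_mul]
  refine integral_congr_ae (ae_of_all _ fun x => ?_)
  simp only [update_self, dotProduct_update_of_eq_zero (hdiag k), quadFun_update ha hdiag]
  set T := a k ⬝ᵥ x
  set u := quadFun a x - 2 * T * x k
  calc ∫ z, z * T * f (u + 2 * T * z) ∂μ
      = T * ∫ z, z * f (u + 2 * T * z) ∂μ := by
        rw [← integral_const_mul]
        exact integral_congr_ae (ae_of_all _ fun z => by ring)
    _ = 2 * ∫ z, steinKernel μ z * T ^ 2 * f' (u + 2 * T * z) ∂μ := by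
        rw [integral_mul_comp_affine h hsmooth hφ hf hf' hC, ← integral_const_mul,
          ← integral_const_mul]
        exact integral_congr_ae (ae_of_all _ fun z => by ring)

theorem isSteinKernelOf_quadFun (h : IsStandardized μ)
    (hsmooth : ContDiffOn ℝ 1 (quantile μ) (Set.Ioo 0 1)) (hφ : Integrable (steinKernel μ) μ)
    (ha : a.IsSymm) (hdiag : ∀ k, a k k = 0) :
    IsSteinKernelOf (Measure.pi fun _ => μ) (quadFun a) (quadKernel (steinKernel μ) a) := by
  intro f f' C hf hf' hC
  have hleft (x : ι → ℝ) : quadFun a x * f (quadFun a x)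
      = ∑ k, x k * (a k ⬝ᵥ x) * f (quadFun a x) := by
    rw [← sum_mul]
    rfl
  have hright (x : ι → ℝ) : quadKernel (steinKernel μ) a x * f' (quadFun a x)
      = ∑ k, 2 * (steinKernel μ (x k) * (a k ⬝ᵥ x) ^ 2 * f' (quadFun a x)) := by
    rw [← mul_sum, ← sum_mul, quadKernel, mul_assoc]
  simp only [hleft, hright]
  rw [integral_finsetSum _ fun k _ => integrable_mul_dotProduct_mul_comp h hdiag hf hC k,
    integral_finsetSum _ fun k _ =>
      (integrable_mul_dotProduct_sq_mul_comp h hφ hdiag hf' hC k).const_mul 2]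
  simp only [integral_mul_dotProduct_mul_comp h hsmooth hφ ha hdiag hf hf' hC, integral_const_mul]

end SteinKernelOfQuadFun

section WeightedSquares

variable {ι : Type*} [Fintype ι]

namespace IsStandardized

variable {μ : Measure ℝ} {ψ : ℝ → ℝ} {b d : ι → ℝ} {k j : ι}

lemma sq_integral_mul_sq_le (h : IsStandardized μ) (hψ : MemLp ψ 2 μ) :
    (∫ z, ψ z * z ^ 2 ∂μ) ^ 2 ≤ (∫ z, ψ z ^ 2 ∂μ) * ∫ z, z ^ 4 ∂μ := by
  simpa only [← pow_mul] using sq_integral_mul_le hψ h.memLp_sq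

variable [IsProbabilityMeasure μ]

lemma sq_integral_mul_id_le (h : IsStandardized μ) (hψ : MemLp ψ 2 μ) :
    (∫ z, ψ z * z ∂μ) ^ 2 ≤ ∫ z, ψ z ^ 2 ∂μ := by
  simpa only [id, h.integral_sq, mul_one] using sq_integral_mul_le hψ h.memLp_id

lemma integral_mul_affine_sq (h : IsStandardized μ) (hψ : MemLp ψ 2 μ) (hψ0 : ∫ z, ψ z ∂μ = 0)
    (u v : ℝ) : ∫ z, ψ z * (u + v * z) ^ 2 ∂μ
      = 2 * v * (∫ z, ψ z * z ∂μ) * u + v ^ 2 * ∫ z, ψ z * z ^ 2 ∂μ := by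
  have hconst := (hψ.integrable one_le_two).const_mul (u ^ 2)
  have hlinear : Integrable (fun z => 2 * u * v * (ψ z * z)) μ :=
    (hψ.integrable_mul h.memLp_id).const_mul _
  have hsquare : Integrable (fun z => v ^ 2 * (ψ z * z ^ 2)) μ :=
    (hψ.integrable_mul h.memLp_sq).const_mul _
  have hexpand (z : ℝ) : ψ z * (u + v * z) ^ 2
      = u ^ 2 * ψ z + 2 * u * v * (ψ z * z) + v ^ 2 * (ψ z * z ^ 2) := by ring
  simp only [hexpand]
  rw [integral_add (hconst.fun_add hlinear) hsquare, integral_add hconst hlinear,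
    integral_const_mul, integral_const_mul, integral_const_mul, hψ0]
  ring

lemma memLp_mul_dotProduct_sq (h : IsStandardized μ) (hψ : MemLp ψ 2 μ) (hb : b k = 0) :
    MemLp (fun x : ι → ℝ => ψ (x k) * (b ⬝ᵥ x) ^ 2) 2 (Measure.pi fun _ => μ) := by
  classical
  have hmeas : AEStronglyMeasurable (fun x : ι → ℝ => ψ (x k) * (b ⬝ᵥ x) ^ 2)
      (Measure.pi fun _ => μ) :=
    (integrable_mul_dotProduct_sq h (hψ.integrable one_le_two) hb).aestronglyMeasurable
  rw [memLp_two_iff_integrable_sq hmeas]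
  simp only [mul_pow]
  exact integrable_mul_of_update_invariant (μ := fun _ => μ) (g := fun z => ψ z ^ 2)
    hψ.integrable_sq (h.memLp_dotProduct_sq b).integrable_sq
    fun x z => by rw [dotProduct_update_of_eq_zero hb]

lemma integral_mul_dotProduct_sq_sq_le (h : IsStandardized μ) (hψ : MemLp ψ 2 μ)
    (hb : b k = 0) :
    ∫ x : ι → ℝ, (ψ (x k) * (b ⬝ᵥ x) ^ 2) ^ 2 ∂(Measure.pi fun _ => μ)
      ≤ (∫ z, ψ z ^ 2 ∂μ) * ((2 + ∫ x, x ^ 4 ∂μ) * (∑ l, b l ^ 2) ^ 2) := by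
  classical
  simp only [mul_pow]
  rw [integral_mul_of_update_invariant (μ := fun _ => μ) (g := fun z => ψ z ^ 2)
    hψ.integrable_sq (h.memLp_dotProduct_sq b).integrable_sq
    fun x z => by rw [dotProduct_update_of_eq_zero hb]]
  exact mul_le_mul_of_nonneg_left (h.integral_dotProduct_sq_sq_le b)
    (integral_nonneg fun z => sq_nonneg _)

lemma integral_update_mul_dotProduct_sq [DecidableEq ι] (h : IsStandardized μ)
    (hψ : MemLp ψ 2 μ) (hψ0 : ∫ z, ψ z ∂μ = 0) {G : (ι → ℝ) → ℝ}
    (hinv : ∀ x z, G (update x k z) = G x) (b : ι → ℝ) (x : ι → ℝ) :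
    ∫ z, G (update x k z) * (ψ (update x k z k) * (b ⬝ᵥ update x k z) ^ 2) ∂μ
      = G x * (2 * b k * (∫ z, ψ z * z ∂μ) * (update b k 0 ⬝ᵥ x)
        + b k ^ 2 * ∫ z, ψ z * z ^ 2 ∂μ) := by
  simp only [hinv, update_self, dotProduct_update, integral_const_mul]
  rw [h.integral_mul_affine_sq hψ hψ0]

lemma integral_affine_mul_affine (h : IsStandardized μ) (b d : ι → ℝ) (u w : ℝ) :
    ∫ x, (u * (b ⬝ᵥ x) + w) * (u * (d ⬝ᵥ x) + w) ∂(Measure.pi fun _ => μ)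
      = u ^ 2 * (b ⬝ᵥ d) + w ^ 2 := by
  have hquad : Integrable (fun x => u ^ 2 * ((b ⬝ᵥ x) * (d ⬝ᵥ x))) (Measure.pi fun _ => μ) :=
    ((h.memLp_dotProduct b).integrable_mul (h.memLp_dotProduct d)).const_mul _
  have hleft := ((h.memLp_dotProduct b).integrable one_le_two).const_mul (u * w)
  have hright := ((h.memLp_dotProduct d).integrable one_le_two).const_mul (u * w)
  have hexpand (x : ι → ℝ) : (u * (b ⬝ᵥ x) + w) * (u * (d ⬝ᵥ x) + w)
      = u ^ 2 * ((b ⬝ᵥ x) * (d ⬝ᵥ x)) + u * w * (b ⬝ᵥ x) + u * w * (d ⬝ᵥ x) + w ^ 2 := by ring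
  simp only [hexpand]
  rw [integral_add ((hquad.fun_add hleft).fun_add hright) (integrable_const _),
    integral_add (hquad.fun_add hleft) hright, integral_add hquad hleft, integral_const_mul,
    integral_const_mul, integral_const_mul, h.integral_dotProduct, h.integral_dotProduct,
    h.integral_dotProduct_mul_dotProduct, integral_const, probReal_univ, one_smul]
  ring

lemma integral_mul_dotProduct_sq_mul (h : IsStandardized μ) (hψ : MemLp ψ 2 μ)
    (hψ0 : ∫ z, ψ z ∂μ = 0) (hkj : k ≠ j) (hb : b k = 0) (hd : d j = 0) (hbd : b j = d k) :
    ∫ x : ι → ℝ, ψ (x k) * (b ⬝ᵥ x) ^ 2 * (ψ (x j) * (d ⬝ᵥ x) ^ 2) ∂(Measure.pi fun _ => μ)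
      = 4 * d k ^ 2 * (∫ z, ψ z * z ∂μ) ^ 2 * (b ⬝ᵥ d)
        + d k ^ 4 * (∫ z, ψ z * z ^ 2 ∂μ) ^ 2 := by
  classical
  set α := ∫ z, ψ z * z ∂μ
  set β := ∫ z, ψ z * z ^ 2 ∂μ
  have hswap (x : ι → ℝ) : ψ (x k) * (b ⬝ᵥ x) ^ 2 * (ψ (x j) * (d ⬝ᵥ x) ^ 2)
      = ψ (x j) * (b ⬝ᵥ x) ^ 2 * (ψ (x k) * (d ⬝ᵥ x) ^ 2) := by ring
  have hint : Integrable
      (fun x : ι → ℝ => ψ (x j) * (b ⬝ᵥ x) ^ 2 * (ψ (x k) * (d ⬝ᵥ x) ^ 2))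
      (Measure.pi fun _ => μ) := by
    simp only [← hswap]
    exact (h.memLp_mul_dotProduct_sq hψ hb).integrable_mul (h.memLp_mul_dotProduct_sq hψ hd)
  have hresample_k := h.integral_update_mul_dotProduct_sq (k := k) hψ hψ0
    (G := fun x => ψ (x j) * (b ⬝ᵥ x) ^ 2)
    (fun x z => by rw [update_of_ne hkj.symm, dotProduct_update_of_eq_zero hb]) d
  have hd' : update d k 0 j = 0 := by rw [update_of_ne hkj.symm, hd]
  have hresample_j := h.integral_update_mul_dotProduct_sq (k := j) hψ hψ0
    (G := fun x => 2 * d k * α * (update d k 0 ⬝ᵥ x) + d k ^ 2 * β)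
    (fun x z => by rw [dotProduct_update_of_eq_zero hd']) b
  have hint_k : Integrable (fun x : ι → ℝ => (2 * d k * α * (update d k 0 ⬝ᵥ x) + d k ^ 2 * β)
      * (ψ (x j) * (b ⬝ᵥ x) ^ 2)) (Measure.pi fun _ => μ) :=
    (integrable_integral_update (i := k) hint).congr
      (ae_of_all _ fun x => (hresample_k x).trans (mul_comm _ _))
  have hdot : update d k 0 ⬝ᵥ update b j 0 = b ⬝ᵥ d := by
    rw [dotProduct_update, hd', zero_mul, add_zero, update_eq_self_iff.2 hd'.symm,
      dotProduct_comm, dotProduct_update, hb, zero_mul, add_zero, update_eq_self_iff.2 hb.symm]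
  -- As `ψ` is centered, integrating out `x k` and then `x j` leaves a product of affine functions.
  simp only [hswap]
  rw [integral_eq_integral_update (i := k) hint]
  simp only [hresample_k]
  simp only [mul_comm (ψ _ * _) (_ + _)]
  rw [integral_eq_integral_update (i := j) hint_k]
  simp only [hresample_j, hbd]
  rw [h.integral_affine_mul_affine, hdot]
  ring

end IsStandardized

end WeightedSquares

section KernelVariance

lemma integral_add_sq_le {α : Type*} [MeasurableSpace α] {ν : Measure α} {f g : α → ℝ}
    (hf : MemLp f 2 ν) (hg : MemLp g 2 ν) :
    ∫ x, (f x + g x) ^ 2 ∂ν ≤ 2 * ((∫ x, f x ^ 2 ∂ν) + ∫ x, g x ^ 2 ∂ν) := by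
  rw [← integral_add hf.integrable_sq hg.integrable_sq, ← integral_const_mul]
  exact integral_mono_of_nonneg (ae_of_all _ fun x => sq_nonneg _)
    ((hf.integrable_sq.add hg.integrable_sq).const_mul 2) (ae_of_all _ fun x => add_sq_le)

variable {ι : Type*} [Fintype ι] {a : Matrix ι ι ℝ} {L : ℝ}

lemma trace_transpose_mul_self (a : Matrix ι ι ℝ) :
    (aᵀ * a).trace = ∑ k, ∑ l, a k l ^ 2 := by
  simp only [trace, Matrix.diag_apply, mul_apply, transpose_apply, ← sq]
  exact sum_comm

lemma transpose_mul_self_apply_self (ha : a.IsSymm) (q : ι) :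
    (aᵀ * a) q q = ∑ l, a q l ^ 2 := by
  simp only [mul_apply, transpose_apply, ha.apply, ← sq]

lemma sum_transpose_mul_self_apply_self_sq_le (ha : a.IsSymm) (hL : ∀ k, ∑ l, a k l ^ 2 ≤ L) :
    ∑ q, (aᵀ * a) q q ^ 2 ≤ L * ∑ k, ∑ l, a k l ^ 2 := by
  simp only [mul_sum, transpose_mul_self_apply_self ha]
  refine sum_le_sum fun q _ => ?_
  rw [sq, ← mul_sum]
  exact mul_le_mul_of_nonneg_right (hL q) (sum_nonneg fun _ _ => sq_nonneg _)

lemma sq_apply_le (hL : ∀ k, ∑ l, a k l ^ 2 ≤ L) (k l : ι) : a k l ^ 2 ≤ L :=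
  (single_le_sum (f := fun l => a k l ^ 2) (fun _ _ => sq_nonneg _) (mem_univ l)).trans (hL k)

lemma row_dotProduct_row_le (hL : ∀ k, ∑ l, a k l ^ 2 ≤ L) (k j : ι) : a k ⬝ᵥ a j ≤ L := by
  have hamgm : a k ⬝ᵥ a j ≤ ∑ l, (a k l ^ 2 + a j l ^ 2) / 2 :=
    sum_le_sum fun l _ => by linarith [two_mul_le_add_sq (a k l) (a j l)]
  rw [← sum_div, sum_add_distrib] at hamgm
  linarith [hL k, hL j]

namespace IsStandardized

variable {μ : Measure ℝ} [IsProbabilityMeasure μ] {ψ φ : ℝ → ℝ}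

lemma integral_quadFun_transpose_mul_self_sub_trace_sq_le (h : IsStandardized μ) (ha : a.IsSymm)
    (hL : ∀ k, ∑ l, a k l ^ 2 ≤ L) :
    ∫ x, (quadFun (aᵀ * a) x - (aᵀ * a).trace) ^ 2 ∂(Measure.pi fun _ => μ)
      ≤ 2 * (∑ q, ∑ l, (aᵀ * a) q l ^ 2) + (∫ x, x ^ 4 ∂μ) * (L * ∑ k, ∑ l, a k l ^ 2) := by
  rw [h.integral_quadFun_sub_trace_sq (isSymm_transpose_mul_self a)]
  have hdiag_nonneg : 0 ≤ ∑ q, (aᵀ * a) q q ^ 2 := sum_nonneg fun _ _ => sq_nonneg _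
  have hdiag := mul_le_mul_of_nonneg_left (sum_transpose_mul_self_apply_self_sq_le ha hL)
    (zero_le_one.trans h.one_le_integral_pow_four)
  linarith

lemma integral_mul_row_sq_sq_le (h : IsStandardized μ) (hψ : MemLp ψ 2 μ)
    (hdiag : ∀ k, a k k = 0) (hL : ∀ k, ∑ l, a k l ^ 2 ≤ L) (k : ι) :
    ∫ x : ι → ℝ, (ψ (x k) * (a k ⬝ᵥ x) ^ 2) ^ 2 ∂(Measure.pi fun _ => μ)
      ≤ (∫ z, ψ z ^ 2 ∂μ) * (2 + ∫ x, x ^ 4 ∂μ) * L * ∑ l, a k l ^ 2 := by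
  calc _ ≤ (∫ z, ψ z ^ 2 ∂μ) * ((2 + ∫ x, x ^ 4 ∂μ) * (∑ l, a k l ^ 2) ^ 2) :=
        h.integral_mul_dotProduct_sq_sq_le hψ (hdiag k)
    _ = (∫ z, ψ z ^ 2 ∂μ) * (2 + ∫ x, x ^ 4 ∂μ) * (∑ l, a k l ^ 2) * ∑ l, a k l ^ 2 := by ring
    _ ≤ _ := by
        gcongr
        exact hL k

lemma integral_mul_row_sq_mul_le (h : IsStandardized μ) (hψ : MemLp ψ 2 μ)
    (hψ0 : ∫ z, ψ z ∂μ = 0) (ha : a.IsSymm) (hdiag : ∀ k, a k k = 0)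
    (hL : ∀ k, ∑ l, a k l ^ 2 ≤ L) {k j : ι} (hkj : k ≠ j) :
    ∫ x : ι → ℝ, ψ (x k) * (a k ⬝ᵥ x) ^ 2 * (ψ (x j) * (a j ⬝ᵥ x) ^ 2) ∂(Measure.pi fun _ => μ)
      ≤ (∫ z, ψ z ^ 2 ∂μ) * (4 + ∫ x, x ^ 4 ∂μ) * L * a k j ^ 2 := by
  rw [h.integral_mul_dotProduct_sq_mul hψ hψ0 hkj (hdiag k) (hdiag j) (ha.apply j k),
    ha.apply k j]
  have hL0 : 0 ≤ L := (sq_nonneg _).trans (sq_apply_le hL k k)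
  have hlinear : 4 * a k j ^ 2 * (∫ z, ψ z * z ∂μ) ^ 2 * (a k ⬝ᵥ a j)
      ≤ 4 * a k j ^ 2 * (∫ z, ψ z ^ 2 ∂μ) * L :=
    (mul_le_mul_of_nonneg_left (row_dotProduct_row_le hL k j) (by positivity)).trans
      (by gcongr; exact h.sq_integral_mul_id_le hψ)
  have hsquare : a k j ^ 4 * (∫ z, ψ z * z ^ 2 ∂μ) ^ 2
      ≤ a k j ^ 2 * L * ((∫ z, ψ z ^ 2 ∂μ) * ∫ x, x ^ 4 ∂μ) := by
    rw [show a k j ^ 4 = a k j ^ 2 * a k j ^ 2 by ring]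
    gcongr
    · exact sq_apply_le hL k j
    · exact h.sq_integral_mul_sq_le hψ
  linarith

lemma integral_sum_mul_row_sq_sq_le (h : IsStandardized μ) (hψ : MemLp ψ 2 μ)
    (hψ0 : ∫ z, ψ z ∂μ = 0) (ha : a.IsSymm) (hdiag : ∀ k, a k k = 0)
    (hL : ∀ k, ∑ l, a k l ^ 2 ≤ L) :
    ∫ x : ι → ℝ, (∑ k, ψ (x k) * (a k ⬝ᵥ x) ^ 2) ^ 2 ∂(Measure.pi fun _ => μ)
      ≤ (∫ z, ψ z ^ 2 ∂μ) * (6 + 2 * ∫ x, x ^ 4 ∂μ) * L * ∑ k, ∑ l, a k l ^ 2 := by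
  classical
  set p := ∫ z, ψ z ^ 2 ∂μ
  set m := ∫ x, x ^ 4 ∂μ
  have hint (k j : ι) : Integrable
      (fun x : ι → ℝ => ψ (x k) * (a k ⬝ᵥ x) ^ 2 * (ψ (x j) * (a j ⬝ᵥ x) ^ 2))
      (Measure.pi fun _ => μ) :=
    (h.memLp_mul_dotProduct_sq hψ (hdiag k)).integrable_mul
      (h.memLp_mul_dotProduct_sq hψ (hdiag j))
  have hterm (k j : ι) : ∫ x : ι → ℝ,
      ψ (x k) * (a k ⬝ᵥ x) ^ 2 * (ψ (x j) * (a j ⬝ᵥ x) ^ 2) ∂(Measure.pi fun _ => μ)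
      ≤ (if k = j then p * (2 + m) * L * ∑ l, a k l ^ 2 else 0)
        + p * (4 + m) * L * a k j ^ 2 := by
    split_ifs with hkj
    · subst hkj
      simp only [← sq, hdiag, zero_pow two_ne_zero, mul_zero, add_zero]
      exact h.integral_mul_row_sq_sq_le hψ hdiag hL k
    · rw [zero_add]
      exact h.integral_mul_row_sq_mul_le hψ hψ0 ha hdiag hL hkj
  simp only [sq (Finset.sum _ _), sum_mul_sum]
  rw [integral_finsetSum _ fun _ _ => integrable_finsetSum _ fun j _ => hint _ j]
  simp only [integral_finsetSum _ fun j _ => hint _ j]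
  refine (sum_le_sum fun k _ => sum_le_sum fun j _ => hterm k j).trans_eq ?_
  simp only [sum_add_distrib, sum_ite_eq, mem_univ, if_true, ← mul_sum]
  ring

lemma memLp_quadKernel (h : IsStandardized μ) (hφ : MemLp φ 2 μ) (hdiag : ∀ k, a k k = 0) :
    MemLp (quadKernel φ a) 2 (Measure.pi fun _ => μ) :=
  (memLp_finsetSum _ fun k _ => h.memLp_mul_dotProduct_sq hφ (hdiag k)).const_mul 2

lemma integral_one_sub_quadKernel_sq_le (h : IsStandardized μ) (hφ : MemLp φ 2 μ)
    (hφ1 : ∫ z, φ z ∂μ = 1) (ha : a.IsSymm) (hdiag : ∀ k, a k k = 0)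
    (hL : ∀ k, ∑ l, a k l ^ 2 ≤ L) (hS : ∑ k, ∑ l, a k l ^ 2 = 1 / 2) :
    ∫ x, (1 - quadKernel φ a x) ^ 2 ∂(Measure.pi fun _ => μ)
      ≤ 16 * ((∫ z, φ z ^ 2 ∂μ) * (2 + ∫ x, x ^ 4 ∂μ) * L + ∑ q, ∑ l, (aᵀ * a) q l ^ 2) := by
  set A : (ι → ℝ) → ℝ := fun x => ∑ k, (φ (x k) - 1) * (a k ⬝ᵥ x) ^ 2
  set B : (ι → ℝ) → ℝ := fun x => quadFun (aᵀ * a) x - (aᵀ * a).trace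
  have hψ : MemLp (fun z => φ z - 1) 2 μ := hφ.sub (memLp_const 1)
  have hφint := hφ.integrable one_le_two
  have hψ0 : ∫ z, (φ z - 1) ∂μ = 0 := by
    simp [integral_sub hφint (integrable_const 1), hφ1]
  have hψsq : ∫ z, (φ z - 1) ^ 2 ∂μ = (∫ z, φ z ^ 2 ∂μ) - 1 := by
    have hvar := variance_eq_sub hφ
    rwa [variance_eq_integral hφ.aestronglyMeasurable.aemeasurable, hφ1, one_pow] at hvar
  have hA2 : MemLp A 2 (Measure.pi fun _ => μ) :=
    memLp_finsetSum _ fun k _ => h.memLp_mul_dotProduct_sq hψ (hdiag k)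
  have hB2 : MemLp B 2 (Measure.pi fun _ => μ) := (h.memLp_quadFun _).sub (memLp_const _)
  have hdecomp (x : ι → ℝ) : 1 - quadKernel φ a x = -2 * (A x + B x) := by
    simp only [A, B, quadKernel, trace_transpose_mul_self, hS, quadFun_transpose_mul_self,
      sub_mul, one_mul, sum_sub_distrib]
    ring
  have hA := h.integral_sum_mul_row_sq_sq_le hψ hψ0 ha hdiag hL
  have hB := h.integral_quadFun_transpose_mul_self_sub_trace_sq_le ha hL
  have hsplit := integral_add_sq_le hA2 hB2
  simp only [hdecomp, mul_pow, integral_const_mul]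
  rw [hψsq, hS] at hA
  rw [hS] at hB
  have hL0 : 0 ≤ L := by
    obtain ⟨k, -⟩ := exists_ne_zero_of_sum_ne_zero (hS.trans_ne (by norm_num))
    exact (sum_nonneg fun _ _ => sq_nonneg _).trans (hL k)
  have hp : 0 ≤ (∫ z, φ z ^ 2 ∂μ) - 1 := hψsq ▸ integral_nonneg fun z => sq_nonneg _
  have hm := h.one_le_integral_pow_four
  nlinarith [mul_nonneg hp hL0, mul_nonneg (mul_nonneg hp hL0) (zero_le_one.trans hm),
    mul_nonneg hL0 (zero_le_one.trans hm)]

end IsStandardized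

end KernelVariance

section Bound

variable {μ : Measure ℝ} {n : ℕ} {a : Matrix (Fin n) (Fin n) ℝ}

lemma sum_transpose_mul_self_sq_le_contractionTerm (ha : a.IsSymm) :
    ∑ q, ∑ l, (aᵀ * a) q l ^ 2 ≤ contractionTerm a := by
  have hlower : ∑ k, (∑ l with l < k, a k l ^ 2) ^ 2 ≤ ∑ q, ∑ l, (aᵀ * a) q l ^ 2 := by
    refine sum_le_sum fun q _ => le_trans ?_ (single_le_sum
      (f := fun l => (aᵀ * a) q l ^ 2) (fun _ _ => sq_nonneg _) (mem_univ q))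
    rw [transpose_mul_self_apply_self ha]
    gcongr
    exact filter_subset _ _
  simp only [mul_apply, transpose_apply] at hlower ⊢
  rw [contractionTerm]
  linarith

lemma sum_sq_le_maxRowSq (a : Matrix (Fin n) (Fin n) ℝ) (k : Fin n) :
    ∑ l, a k l ^ 2 ≤ maxRowSq a :=
  le_ciSup (f := fun k => ∑ l, a k l ^ 2) (Set.finite_range _).bddAbove k

lemma maxRowSq_nonneg (a : Matrix (Fin n) (Fin n) ℝ) : 0 ≤ maxRowSq a :=
  Real.iSup_nonneg fun _ => sum_nonneg fun _ _ => sq_nonneg _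

lemma maxRowSq_pos (ha : a ≠ 0) : 0 < maxRowSq a := by
  by_contra! hle
  refine ha (Matrix.ext fun k l => ?_)
  exact (sq_nonpos_iff _).1 ((sq_apply_le (sum_sq_le_maxRowSq a) k l).trans hle)

lemma boundRoot_eq_top (ha : a ≠ 0)
    (hkernel : ∫⁻ x, ENNReal.ofReal (steinKernel μ x ^ 2) ∂μ ≠ 0)
    (htop : ∫⁻ x, ENNReal.ofReal (steinKernel μ x ^ 2) ∂μ = ∞
      ∨ ∫⁻ x, ENNReal.ofReal (x ^ 4) ∂μ = ∞) : boundRoot μ a = ∞ := by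
  have hrow : ENNReal.ofReal (maxRowSq a) ≠ 0 := by simpa using maxRowSq_pos ha
  have hmul : (∫⁻ x, ENNReal.ofReal (steinKernel μ x ^ 2) ∂μ)
      * (2 + ∫⁻ x, ENNReal.ofReal (x ^ 4) ∂μ) = ∞ := by
    rcases htop with htop | htop
    · rw [htop, ENNReal.top_mul (by simp)]
    · rw [htop, add_top, ENNReal.mul_top hkernel]
  rw [boundRoot, hmul, ENNReal.top_mul hrow, top_add, ENNReal.top_rpow_of_pos (by norm_num)]

lemma boundRoot_eq_ofReal (ha : a.IsSymm) (hkernel : Integrable (fun x => steinKernel μ x ^ 2) μ)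
    (hfour : Integrable (fun x => x ^ 4) μ) :
    boundRoot μ a = ENNReal.ofReal (√((∫ x, steinKernel μ x ^ 2 ∂μ) * (2 + ∫ x, x ^ 4 ∂μ)
      * maxRowSq a + contractionTerm a)) := by
  have hrow := maxRowSq_nonneg a
  have hcontraction := contractionTerm_nonneg a ha
  have hfour_nonneg : 0 ≤ ∫ x, x ^ 4 ∂μ := integral_nonneg fun x => by positivity
  have hkernel_nonneg : 0 ≤ ∫ x, steinKernel μ x ^ 2 ∂μ := integral_nonneg fun x => sq_nonneg _
  rw [boundRoot, ← ofReal_integral_eq_lintegral_ofReal hkernel (ae_of_all _ fun x => sq_nonneg _),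
    ← ofReal_integral_eq_lintegral_ofReal hfour (ae_of_all _ fun x => by positivity),
    ← ENNReal.ofReal_ofNat 2, ← ENNReal.ofReal_add zero_le_two hfour_nonneg,
    ← ENNReal.ofReal_mul hkernel_nonneg, ← ENNReal.ofReal_mul (by positivity),
    ← ENNReal.ofReal_add (by positivity) hcontraction,
    ENNReal.ofReal_rpow_of_nonneg (by positivity) (by norm_num), Real.sqrt_eq_rpow]

lemma lintegral_steinKernel_sq_ne_zero [IsProbabilityMeasure μ]
    (hsmooth : ContDiffOn ℝ 1 (quantile μ) (Set.Ioo 0 1)) (hmem : MemLp id 2 μ)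
    (hmean : ∫ x, x ∂μ = 0) (hvar : ∫ x, x ^ 2 ∂μ = 1) :
    ∫⁻ x, ENNReal.ofReal (steinKernel μ x ^ 2) ∂μ ≠ 0 := by
  intro hzero
  rw [lintegral_eq_zero_iff ((measurable_steinKernel μ).pow_const 2).ennreal_ofReal] at hzero
  have hkernel : steinKernel μ =ᵐ[μ] 0 := by
    filter_upwards [hzero] with x hx
    exact (sq_nonpos_iff _).1 (ENNReal.ofReal_eq_zero.1 hx)
  have hone := integral_steinKernel hsmooth hmem hmean ((integrable_zero _ _ _).congr hkernel.symm)
  rw [hvar, integral_congr_ae hkernel] at hone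
  simp at hone

end Bound

section GaussianApproximation

lemma integral_abs_le_sqrt {α : Type*} [MeasurableSpace α] {P : Measure α}
    [IsProbabilityMeasure P] {Y : α → ℝ} (hY : MemLp Y 2 P) :
    ∫ ω, |Y ω| ∂P ≤ √(∫ ω, Y ω ^ 2 ∂P) := by
  refine Real.le_sqrt_of_sq_le ?_
  simpa using sq_integral_mul_le hY.abs (memLp_const (1 : ℝ))

variable {μ : Measure ℝ} [IsProbabilityMeasure μ] {n : ℕ} {a : Matrix (Fin n) (Fin n) ℝ}

lemma IsStandardized.sum_sq_eq_half (h : IsStandardized μ) (ha : a.IsSymm)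
    (hdiag : ∀ k, a k k = 0) (hnorm : ∫ x, quadFun a x ^ 2 ∂(Measure.pi fun _ => μ) = 1) :
    ∑ k, ∑ l, a k l ^ 2 = 1 / 2 := by
  rw [h.integral_quadFun_sq ha] at hnorm
  simp only [trace, Matrix.diag_apply, hdiag, sum_const_zero, ne_eq, OfNat.ofNat_ne_zero,
    not_false_eq_true, zero_pow, mul_zero, zero_add, add_zero] at hnorm
  linarith

lemma integral_abs_one_sub_quadKernel_le (h : IsStandardized μ)
    (hsmooth : ContDiffOn ℝ 1 (quantile μ) (Set.Ioo 0 1)) (hkernel : MemLp (steinKernel μ) 2 μ)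
    (ha : a.IsSymm) (hdiag : ∀ k, a k k = 0)
    (hnorm : ∫ x, quadFun a x ^ 2 ∂(Measure.pi fun _ => μ) = 1) :
    ENNReal.ofReal (∫ x, |1 - quadKernel (steinKernel μ) a x| ∂(Measure.pi fun _ => μ))
      ≤ 4 * boundRoot μ a := by
  have hmean_kernel : ∫ x, steinKernel μ x ∂μ = 1 :=
    (integral_steinKernel hsmooth h.memLp_id h.integral_id
      (hkernel.integrable one_le_two)).trans h.integral_sq
  have hsecond := h.integral_one_sub_quadKernel_sq_le hkernel hmean_kernel ha hdiag
    (sum_sq_le_maxRowSq a) (h.sum_sq_eq_half ha hdiag hnorm)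
  rw [boundRoot_eq_ofReal ha hkernel.integrable_sq h.integrable_pow_four,
    ← ENNReal.ofReal_ofNat 4, ← ENNReal.ofReal_mul zero_le_four]
  refine ENNReal.ofReal_le_ofReal
    ((integral_abs_le_sqrt ((memLp_const 1).sub (h.memLp_quadKernel hkernel hdiag))).trans ?_)
  rw [← Real.sqrt_sq zero_le_four, ← Real.sqrt_mul (sq_nonneg 4)]
  refine Real.sqrt_le_sqrt (hsecond.trans ?_)
  linarith [sum_transpose_mul_self_sq_le_contractionTerm ha]

theorem quadFun_gaussian_bounds (hsmooth : ContDiffOn ℝ 1 (quantile μ) (Set.Ioo 0 1))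
    (hmean : ∫ x, x ∂μ = 0) (hvar : ∫ x, x ^ 2 ∂μ = 1) (ha : a.IsSymm) (hdiag : ∀ k, a k k = 0)
    (hnorm : ∫ x, quadFun a x ^ 2 ∂(Measure.pi fun _ => μ) = 1) :
    wassersteinDist ((Measure.pi fun _ => μ).map (quadFun a)) (gaussianReal 0 1)
        ≤ 4 * boundRoot μ a
    ∧ totalVariationDist ((Measure.pi fun _ => μ).map (quadFun a)) (gaussianReal 0 1)
        ≤ 8 * boundRoot μ a := by
  by_cases htop : ∫⁻ x, ENNReal.ofReal (steinKernel μ x ^ 2) ∂μ = ∞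
      ∨ ∫⁻ x, ENNReal.ofReal (x ^ 4) ∂μ = ∞
  · have hmem : MemLp id 2 μ := (memLp_two_iff_integrable_sq aestronglyMeasurable_id).2
      (not_imp_comm.1 integral_undef (hvar.trans_ne one_ne_zero))
    have ha0 : a ≠ 0 := by
      rintro rfl
      simp [quadFun] at hnorm
    rw [boundRoot_eq_top ha0 (lintegral_steinKernel_sq_ne_zero hsmooth hmem hmean hvar) htop,
      ENNReal.mul_top four_ne_zero, ENNReal.mul_top (OfNat.ofNat_ne_zero 8)]
    exact ⟨le_top, le_top⟩
  push Not at htop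
  have hkernel : MemLp (steinKernel μ) 2 μ :=
    (memLp_two_iff_integrable_sq (measurable_steinKernel μ).aestronglyMeasurable).2
      ((lintegral_ofReal_ne_top_iff_integrable
        ((measurable_steinKernel μ).pow_const 2).aestronglyMeasurable
        (ae_of_all _ fun x => sq_nonneg _)).1 htop.1)
  have hstd : IsStandardized μ := ⟨hmean, hvar, (lintegral_ofReal_ne_top_iff_integrable
    (by fun_prop) (ae_of_all _ fun x => by positivity)).1 htop.2⟩
  have hkernel_int := hkernel.integrable one_le_two
  have hH := (hstd.memLp_quadKernel hkernel hdiag).integrable one_le_two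
  have hstein := isSteinKernelOf_quadFun hstd hsmooth hkernel_int ha hdiag
  have habs := integral_abs_one_sub_quadKernel_le hstd hsmooth hkernel ha hdiag hnorm
  refine ⟨(wassersteinDist_gaussian_le (measurable_quadFun a)
    ((hstd.memLp_quadFun a).integrable one_le_two) hH hstein).trans habs,
    (totalVariationDist_gaussian_le (measurable_quadFun a) hH hstein).trans ?_⟩
  rw [ENNReal.ofReal_mul zero_le_two, ENNReal.ofReal_ofNat,
    show (8 : ℝ≥0∞) = 2 * 4 by norm_num, mul_assoc]
  gcongr

end GaussianApproximation

section Law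

lemma quadForm_eq_quadFun {Ω : Type*} {n : ℕ} (a : Matrix (Fin n) (Fin n) ℝ) (X : ℕ → Ω → ℝ) :
    quadForm a X = quadFun a ∘ fun ω (i : Fin n) => X i ω := by
  ext ω
  simp only [quadForm, Function.comp_apply, quadFun_eq_sum, mul_assoc]

lemma map_eq_pi_of_iIndepFun_of_identDistrib {Ω : Type*} [MeasurableSpace Ω] {P : Measure Ω}
    [IsProbabilityMeasure P] {X : ℕ → Ω → ℝ} (hindep : iIndepFun X P)
    (hident : ∀ k, IdentDistrib (X k) (X 0) P P) (n : ℕ) :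
    P.map (fun ω (i : Fin n) => X i ω) = Measure.pi fun _ => P.map (X 0) := by
  rw [(iIndepFun_iff_map_fun_eq_pi_map fun i : Fin n => (hident i).aemeasurable_fst).1
    (hindep.precomp Fin.val_injective)]
  simp only [(hident _).map_eq]

end Law

end SteinQuadForm

theorem corollary7p4 {Ω : Type*} [MeasurableSpace Ω] (P : Measure Ω) [IsProbabilityMeasure P]
    (X : ℕ → Ω → ℝ) (hindep : iIndepFun X P) (hident : ∀ k, IdentDistrib (X k) (X 0) P P)
    (hmean : ∫ ω, X 0 ω ∂P = 0) (hvar : ∫ ω, X 0 ω ^ 2 ∂P = 1)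
    (hsmooth : ContDiffOn ℝ 1 (SteinQuadForm.quantile (P.map (X 0))) (Set.Ioo 0 1))
    (n : ℕ) (a : Matrix (Fin n) (Fin n) ℝ) (hsymm : a.IsSymm) (hdiag : ∀ k, a k k = 0)
    (hnorm : ∫ ω, SteinQuadForm.quadForm a X ω ^ 2 ∂P = 1) :
    SteinQuadForm.wassersteinDist (P.map (SteinQuadForm.quadForm a X)) (gaussianReal 0 1)
        ≤ 4 * SteinQuadForm.boundRoot (P.map (X 0)) a
    ∧ SteinQuadForm.totalVariationDist (P.map (SteinQuadForm.quadForm a X)) (gaussianReal 0 1)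
        ≤ 8 * SteinQuadForm.boundRoot (P.map (X 0)) a := by
  have hX (k : ℕ) : AEMeasurable (X k) P := (hident k).aemeasurable_fst
  have hprob : IsProbabilityMeasure (P.map (X 0)) := Measure.isProbabilityMeasure_map (hX 0)
  have hvec : AEMeasurable (fun ω (i : Fin n) => X i ω) P :=
    aemeasurable_pi_lambda _ fun i => hX i
  have hlaw := SteinQuadForm.map_eq_pi_of_iIndepFun_of_identDistrib hindep hident n
  have hQ := SteinQuadForm.measurable_quadFun a
  rw [SteinQuadForm.quadForm_eq_quadFun] at hnorm ⊢
  rw [← AEMeasurable.map_map_of_aemeasurable hQ.aemeasurable hvec, hlaw]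
  refine SteinQuadForm.quadFun_gaussian_bounds hsmooth ?_ ?_ hsymm hdiag ?_
  · rwa [integral_map (hX 0) (by fun_prop)]
  · rwa [integral_map (hX 0) (by fun_prop)]
  · rwa [← hlaw, integral_map hvec (hQ.pow_const 2).aestronglyMeasurable]
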